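/- Let $n\ge 1$, $\rho>0$, $c\ge 0$. **The metric.** Let $K=\{X\in\mathbb C^{n-1}:\|X\|<1\}\times\mathbb R\times\mathbb C^n$ with coordinates $(X^a)_{1\le a\le n-1}$, $\tilde\phi$, $(w^k)_{0\le k\le n-1}$, and let $\bar N_\rho=\{\rho\}\times K$ carry the Riemannian metric $$\begin{aligned}g_\rho^c={}&\tfrac{\rho+c}{\rho}\tfrac1{1-\|X\|^2}\Big(\sum_a|dX^a|^2+\tfrac1{1-\|X\|^2}\Big|\sum_a\bar X^a dX^a\Big|^2\Big)\\&+\tfrac1{4\rho^2}\tfrac{\rho+c}{\rho+2c}\Big(d\tilde\phi-4\,\mathrm{Im}\big(\bar w^0dw^0-\sum_a\bar w^adw^a\big)+\tfrac{2c}{1-\|X\|^2}\mathrm{Im}\sum_a\bar X^adX^a\Big)^2\\&-\tfrac2\rho\Big(|dw^0|^2-\sum_a|dw^a|^2\Big)+\tfrac{\rho+c}{\rho^2}\tfrac4{1-\|X\|^2}\Big|dw^0+\sum_aX^adw^a\Big|^2 .\end{aligned}$$ Let $p_\rho=(\rho,0)$. **The Lie algebra.** On $\mathfrak{gl}(n,\mathbb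 C)$ (indices $0,\dots,n-1$) put $A^\sigma=-I\bar A^\top I$ with $I=\mathrm{diag}(-1,1,\dots,1)$, so that $\mathfrak u(1,n-1)=\{A: A^\sigma=A\}$. Let $U_a$ be the matrix with entry $1$ at $(0,a)$ and $0$ elsewhere, $B_a=(1+\delta_{1a})U_a-[U_a,U_1^\sigma]$, $B_a^R=\frac12(B_a+B_a^\sigma)$, $B_a^I=\frac1{2i}(B_a-B_a^\sigma)$ for $1\le a\le n-1$, and let $\mathfrak b\subset\mathfrak{su}(1,n-1)$ be the (Iwasawa) real Lie subalgebra generated by all $B_a^R,B_a^I$ ($\mathfrak b=0$ if $n=1$). Let $\mathfrak{heis}_{2n+1}=\mathbb C^n\oplus\mathbb RZ$ with $Z$ central and $[v,v']=\omega(v,v')Z$, $\omega(v,v')=\mathrm{Im}(\bar v_0v_0'-\sum_{a\ge1}\bar v_av_a')$; let $e_0,\dots,e_{n-1}$ be the standard basis of $\mathbb C^n$ and $f_k=ie_k$. Let $\mathfrak l=\mathfrak b\ltimes\mathfrak{heis}_{2n+1}$ with $[A,v]=-A^\top v$ and $[A,Z]=0$ for $A\in\mathfrak b$, $v\in\mathbb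 C^n$. **The identification.** The element $x=A+v+sZ\in\mathfrak l$ acts infinitesimally on $\bar N_\rho$ by the vector field $\alpha(x)$ with components, where $\mu=A_{00}+\sum_bA_{0b}X^b$, $$\dot X^a=A_{a0}+\sum_bA_{ab}X^b-\mu X^a,\qquad \dot{\tilde\phi}=-2c\,\mathrm{Im}\,\mu+\sqrt2\,\omega(v,w)+s,\qquad \dot w=-A^\top w+\tfrac1{2\sqrt2}v .$$ Let $\alpha_\rho:\mathfrak l\to T_{p_\rho}\bar N_\rho$, $x\mapsto\alpha(x)|_{p_\rho}$. **Claim.** The map $\alpha_\rho$ is a linear isomorphism, and $$\mathcal B_n=(B_1^R,B_1^I,\dots,B_{n-1}^R,B_{n-1}^I,e_0,f_0,e_1,f_1,\dots,e_{n-1},f_{n-1},Z)$$ (which is $(e_0,f_0,Z)$ for $n=1$) is a basis of $\mathfrak l$. Through $\alpha_\rho$, regard $g_\rho^c|_{p_\rho}$ as an inner product on $\mathfrak l$, and the Ricci endomorphism $\mathrm{ric}_\rho^c$ of the Riemannian manifold $(\bar N_\rho,g_\rho^c)$ at $p_\rho$ as an endomorphism of $\mathfrak l$. Let $E_{i,j}$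 be the matrix with $1$ at $(i,j)$ and zeros elsewhere, $\mathbb 1_k$ the $k\times k$ identity matrix, and put $$\begin{aligned}r_1&=\frac{-2(n+2)\rho^2-4(n+2)c\rho-6c^2}{(\rho+c)(\rho+2c)},\qquad r_4=-\frac{2(\rho+3c)}{\rho+2c},\\ r_2&=\frac{2n\rho^4+(12n-8)c\rho^3+(28n-26)c^2\rho^2+32(n-1)c^3\rho+16(n-1)c^4}{(\rho+c)(\rho+2c)^3},\\ r_3&=2\,\frac{-\rho^3+(2n-3)c\rho^2+(8n-8)c^2\rho+(8n-8)c^3}{(\rho+2c)^3}.\end{aligned}$$ With respect to $\mathcal B_n$: 1. If $n>1$, the Gram matrix of $g_\rho^c$ is $$\mathrm{diag}\Big(\tfrac{\rho+c}{\rho},\tfrac{(\rho+c)^3}{\rho^2(\rho+2c)},\tfrac{\rho+c}{4\rho}\mathbb 1_{2n-4},\tfrac{\rho+2c}{4\rho^2}\mathbb 1_2,\tfrac1{4\rho}\mathbb 1_2,\tfrac1{4\rho}\mathbb 1_{2n-4},\tfrac1{4\rho^2}\tfrac{\rho+c}{\rho+2c}\Big)-\tfrac{c}{2\rho^2}\tfrac{\rho+c}{\rho+2c}\big(E_{2,4n-1}+E_{4n-1,2}\big).$$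 2. If $n>1$, the matrix of $\mathrm{ric}_\rho^c$ is $$\mathrm{diag}\big(r_1\mathbb 1_{2n-2},r_3\mathbb 1_2,r_4\mathbb 1_{2n-2},r_2\big)+2c(r_1-r_2)E_{4n-1,2}.$$ 3. If $n=1$, the Gram matrix of $g_\rho^c$ and the matrix of $\mathrm{ric}_\rho^c$ are $$\mathrm{diag}\Big(\tfrac{2c+\rho}{4\rho^2},\tfrac{2c+\rho}{4\rho^2},\tfrac{c+\rho}{4(2c+\rho)\rho^2}\Big)\quad\text{and}\quad\frac{2\rho^2(c+\rho)}{(2c+\rho)^3}\,\mathrm{diag}(-1,-1,1).$$ -/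

import Mathlib

/-!
Throughout `m : ℕ` stands for `n - 1`, so that `n = m + 1 ≥ 1` and `4 n - 1 = 4 m + 3`.
Indices `0, …, n-1` are elements of `Fin (m + 1)`; an index `a ∈ {1, …, n-1}` is `Fin.succ a'`
with `a' : Fin m`.
-/

set_option maxSynthPendingDepth 3

open scoped ComplexConjugate

noncomputable section

namespace OneLoop

attribute [local instance] LieRing.ofAssociativeRing

/-! ### Ricci curvature of a metric on (an open subset of) a vector space -/

section Curvature

variable {V : Type*} [NormedAddCommGroup V] [NormedSpace ℝ V]

/-- The Christoffel symbols of the first kind of a metric `g`: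
`2 Γ_x(u, v; w) = (∂_u g)(v, w) + (∂_v g)(u, w) - (∂_w g)(u, v)`. -/
def christoffelFirst (g : V → V →L[ℝ] V →L[ℝ] ℝ) (x : V) : V →L[ℝ] V →L[ℝ] V →L[ℝ] ℝ :=
  (1 / 2 : ℝ) • (fderiv ℝ g x + (fderiv ℝ g x).flip
    - (ContinuousLinearMap.flipₗᵢ ℝ V V ℝ).toContinuousLinearEquiv.toContinuousLinearMap.comp
        (fderiv ℝ g x).flip)

theorem christoffelFirst_apply (g : V → V →L[ℝ] V →L[ℝ] ℝ) (x u v w : V) :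
    christoffelFirst g x u v w =
      (1 / 2) * (fderiv ℝ g x u v w + fderiv ℝ g x v u w - fderiv ℝ g x w u v) := by
  simp [christoffelFirst]

/-- The Christoffel symbols (of the second kind) `Γ_x(u, v) ∈ V`, so that the Levi-Civita
connection is `∇_X Y = DY(X) + Γ(X, Y)`: the index of `christoffelFirst` is raised with `g x`. -/
def christoffel (g : V → V →L[ℝ] V →L[ℝ] ℝ) (x : V) : V →L[ℝ] V →L[ℝ] V :=
  (ContinuousLinearMap.compL ℝ V (V →L[ℝ] ℝ) V (g x).inverse).comp (christoffelFirst g x)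

/-- The endomorphism `u ↦ R(u, v) w` for the curvature tensor
`R(u, v) w = (∂_u Γ)(v, w) - (∂_v Γ)(u, w) + Γ(u, Γ(v, w)) - Γ(v, Γ(u, w))`
at `x`, i.e. `R(X, Y) Z = ∇_X ∇_Y Z - ∇_Y ∇_X Z - ∇_[X, Y] Z`. -/
def curvatureEnd (g : V → V →L[ℝ] V →L[ℝ] ℝ) (x v w : V) : V →ₗ[ℝ] V where
  toFun u :=
    fderiv ℝ (christoffel g) x u v w - fderiv ℝ (christoffel g) x v u w
      + christoffel g x u (christoffel g x v w) - christoffel g x v (christoffel g x u w)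
  map_add' a b := by simp; abel
  map_smul' t a := by simp [smul_sub, smul_add]

/-- The Ricci tensor `Ric_x(v, w) = tr (u ↦ R(u, v) w)`. -/
def ricci (g : V → V →L[ℝ] V →L[ℝ] ℝ) (x : V) : V →ₗ[ℝ] V →ₗ[ℝ] ℝ :=
  LinearMap.mk₂ ℝ (fun v w => LinearMap.trace ℝ V (curvatureEnd g x v w))
    (fun v v' w => by
      rw [← map_add]; congr 1; ext u; simp [curvatureEnd]; abel)
    (fun t v w => by
      rw [← map_smul]; congr 1; ext u; simp [curvatureEnd, smul_sub, smul_add])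
    (fun v w w' => by
      rw [← map_add]; congr 1; ext u; simp [curvatureEnd]; abel)
    (fun t v w => by
      rw [← map_smul]; congr 1; ext u; simp [curvatureEnd, smul_sub, smul_add])

/-- The Ricci endomorphism at `x`: `g_x(ric v, w) = Ric_x(v, w)`. -/
def ricciEnd [FiniteDimensional ℝ V] (g : V → V →L[ℝ] V →L[ℝ] ℝ) (x : V) : V →ₗ[ℝ] V :=
  ((g x).inverse : (V →L[ℝ] ℝ) →ₗ[ℝ] V) ∘ₗ
    (LinearMap.toContinuousLinearMap : (V →ₗ[ℝ] ℝ) ≃ₗ[ℝ] (V →L[ℝ] ℝ)).toLinearMap ∘ₗ ricci g x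

end Curvature

/-! ### The metric `g_ρ^c` on the hypersurface -/

/-- The real vector space `ℂ^(n-1) × ℝ × ℂ^n` of the coordinates `(X, φ̃, w)`. The hypersurface
is the open subset `‖X‖² < 1` in it, and its base point `p_ρ` is the origin. -/
abbrev Coord (m : ℕ) : Type := (Fin m → ℂ) × ℝ × (Fin (m + 1) → ℂ)

section Metric

variable {V : Type*} [NormedAddCommGroup V] [NormedSpace ℝ V]

/-- The symmetric square `η²` of a real linear form. -/
def sqForm (η : V →L[ℝ] ℝ) : V →L[ℝ] V →L[ℝ] ℝ := η.smulRight η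

/-- The symmetric bilinear form `|η|² = (Re η)² + (Im η)²` of a complex valued form. -/
def absSqForm (η : V →L[ℝ] ℂ) : V →L[ℝ] V →L[ℝ] ℝ :=
  sqForm (Complex.reCLM.comp η) + sqForm (Complex.imCLM.comp η)

end Metric

/-- `dX^a` -/
def dX {m : ℕ} (a : Fin m) : Coord m →L[ℝ] ℂ :=
  (ContinuousLinearMap.proj a).comp (ContinuousLinearMap.fst ℝ (Fin m → ℂ) _)

/-- `dφ̃` -/
def dphi {m : ℕ} : Coord m →L[ℝ] ℝ :=
  (ContinuousLinearMap.fst ℝ ℝ (Fin (m + 1) → ℂ)).comp (ContinuousLinearMap.snd ℝ (Fin m → ℂ) _)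

/-- `dw^k` -/
def dw {m : ℕ} (k : Fin (m + 1)) : Coord m →L[ℝ] ℂ :=
  (ContinuousLinearMap.proj k).comp
    ((ContinuousLinearMap.snd ℝ ℝ (Fin (m + 1) → ℂ)).comp
      (ContinuousLinearMap.snd ℝ (Fin m → ℂ) _))

/-- `1 - ‖X‖²` -/
def defect {m : ℕ} (p : Coord m) : ℝ := 1 - ∑ a, ‖p.1 a‖ ^ 2

/-- The `ℂ`-valued form `∑ₐ X̄^a dX^a` at `p`. -/
def XdX {m : ℕ} (p : Coord m) : Coord m →L[ℝ] ℂ := ∑ a, conj (p.1 a) • dX a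

/-- The `ℝ`-valued form
`dφ̃ - 4 Im (w̄^0 dw^0 - ∑ₐ w̄^a dw^a) + 2c / (1 - ‖X‖²) Im (∑ₐ X̄^a dX^a)` at `p`. -/
def theta {m : ℕ} (c : ℝ) (p : Coord m) : Coord m →L[ℝ] ℝ :=
  dphi
    - (4 : ℝ) • Complex.imCLM.comp
        (conj (p.2.2 0) • dw 0 - ∑ a : Fin m, conj (p.2.2 a.succ) • dw a.succ)
    + (2 * c / defect p) • Complex.imCLM.comp (XdX p)

/-- The metric `g_ρ^c` on the hypersurface `{ρ} × K`, `K = {‖X‖² < 1} ⊆ ℂ^(n-1) × ℝ × ℂ^n`. -/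
def gmet (m : ℕ) (ρ c : ℝ) (p : Coord m) : Coord m →L[ℝ] Coord m →L[ℝ] ℝ :=
  ((ρ + c) / ρ * (1 / defect p)) •
      ((∑ a, absSqForm (dX a)) + (1 / defect p) • absSqForm (XdX p))
    + (1 / (4 * ρ ^ 2) * ((ρ + c) / (ρ + 2 * c))) • sqForm (theta c p)
    - (2 / ρ) • (absSqForm (dw 0) - ∑ a : Fin m, absSqForm (dw a.succ))
    + ((ρ + c) / ρ ^ 2 * (4 / defect p)) •
        absSqForm (dw 0 + ∑ a : Fin m, p.1 a • dw a.succ)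

/-! ### The Lie algebra `𝔲(1, n-1)` and its Iwasawa subalgebra `𝔟` -/

/-- The matrix `I = diag(-1, 1, …, 1)` of the pseudo-Hermitian form. -/
def signMat (m : ℕ) : Matrix (Fin (m + 1)) (Fin (m + 1)) ℂ :=
  Matrix.diagonal fun k => if k = 0 then -1 else 1

/-- The antilinear involution `A ↦ A^σ = -I Āᵀ I` of `𝔤𝔩(n, ℂ)`. -/
def sigma {m : ℕ} (A : Matrix (Fin (m + 1)) (Fin (m + 1)) ℂ) :
    Matrix (Fin (m + 1)) (Fin (m + 1)) ℂ :=
  -(signMat m * A.conjTranspose * signMat m)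

theorem signMat_mul_self (m : ℕ) : signMat m * signMat m = 1 := by
  rw [signMat, Matrix.diagonal_mul_diagonal, ← Matrix.diagonal_one]
  congr 1; ext k; split_ifs <;> simp

theorem signMat_conjTranspose (m : ℕ) : (signMat m).conjTranspose = signMat m := by
  rw [signMat, Matrix.diagonal_conjTranspose]
  congr 1; ext k; by_cases h : k = 0 <;> simp [h]

theorem sigma_sigma {m : ℕ} (A : Matrix (Fin (m + 1)) (Fin (m + 1)) ℂ) :
    sigma (sigma A) = A := by
  have h := signMat_mul_self m
  simp only [sigma, Matrix.conjTranspose_neg, Matrix.conjTranspose_mul, signMat_conjTranspose,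
    Matrix.conjTranspose_conjTranspose, Matrix.mul_neg, Matrix.neg_mul, neg_neg]
  calc signMat m * (signMat m * (A * signMat m)) * signMat m
      = (signMat m * signMat m) * A * (signMat m * signMat m) := by simp only [Matrix.mul_assoc]
    _ = A := by simp [h]

theorem sigma_add {m : ℕ} (A B : Matrix (Fin (m + 1)) (Fin (m + 1)) ℂ) :
    sigma (A + B) = sigma A + sigma B := by
  simp [sigma, Matrix.mul_add, Matrix.add_mul]; abel

theorem sigma_smul {m : ℕ} (z : ℂ) (A : Matrix (Fin (m + 1)) (Fin (m + 1)) ℂ) :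
    sigma (z • A) = conj z • sigma A := by
  simp [sigma, Matrix.conjTranspose_smul]

theorem sigma_mul {m : ℕ} (A B : Matrix (Fin (m + 1)) (Fin (m + 1)) ℂ) :
    sigma (A * B) = -(sigma B * sigma A) := by
  have h := signMat_mul_self m
  simp only [sigma, Matrix.conjTranspose_mul, Matrix.mul_neg, Matrix.neg_mul, neg_neg]
  congr 1
  calc signMat m * (B.conjTranspose * A.conjTranspose) * signMat m
      = signMat m * B.conjTranspose * 1 * A.conjTranspose * signMat m := by
        simp only [Matrix.mul_assoc, Matrix.mul_one]
    _ = _ := by rw [← h]; simp only [Matrix.mul_assoc]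

/-- `𝔲(1, n-1)`, the fixed points of `σ` in `𝔤𝔩(n, ℂ)`, as a real Lie algebra. -/
def u1 (m : ℕ) : LieSubalgebra ℝ (Matrix (Fin (m + 1)) (Fin (m + 1)) ℂ) where
  carrier := {A | sigma A = A}
  add_mem' {A B} hA hB := by
    simp only [Set.mem_ofPred_eq] at *; rw [sigma_add, hA, hB]
  zero_mem' := by simp [sigma]
  smul_mem' t A hA := by
    simp only [Set.mem_ofPred_eq] at *
    have : t • A = (t : ℂ) • A := by ext; simp
    rw [this, sigma_smul, hA]; simp
  lie_mem' {A B} hA hB := by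
    change sigma (A * B - B * A) = A * B - B * A
    change sigma A = A at hA
    change sigma B = B at hB
    have : A * B - B * A = A * B + (-1 : ℂ) • (B * A) := by simp [sub_eq_add_neg]
    rw [this, sigma_add, sigma_smul, sigma_mul, sigma_mul, hA, hB]
    simp [add_comm]

/-- `Re A = (A + A^σ) / 2 ∈ 𝔲(1, n-1)` -/
def rePart {m : ℕ} (A : Matrix (Fin (m + 1)) (Fin (m + 1)) ℂ) : u1 m :=
  ⟨(1 / 2 : ℂ) • (A + sigma A), by
    change sigma _ = _
    rw [sigma_smul, sigma_add, sigma_sigma, add_comm (sigma A)]; simp [Complex.conj_ofNat]⟩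

/-- `Im A = (A - A^σ) / (2 i) ∈ 𝔲(1, n-1)` -/
def imPart {m : ℕ} (A : Matrix (Fin (m + 1)) (Fin (m + 1)) ℂ) : u1 m :=
  ⟨(1 / (2 * Complex.I) : ℂ) • (A + (-1 : ℂ) • sigma A), by
    change sigma _ = _
    rw [sigma_smul, sigma_add, sigma_smul, sigma_sigma]
    ext i j; simp [Complex.conj_ofNat]; ring⟩

/-- `U_a`, the matrix with entry `1` in position `(0, a)` and zeros elsewhere. -/
def Umat {m : ℕ} (a : Fin m) : Matrix (Fin (m + 1)) (Fin (m + 1)) ℂ :=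
  Matrix.single 0 a.succ 1

/-- `B_a = (1 + δ_{1a}) U_a - [U_a, U_1^σ]`; the index `1` is `⟨0, a.pos⟩ : Fin m`. -/
def Bmat {m : ℕ} (a : Fin m) : Matrix (Fin (m + 1)) (Fin (m + 1)) ℂ :=
  (if a.val = 0 then 2 else 1 : ℂ) • Umat a - ⁅Umat a, sigma (Umat ⟨0, a.pos⟩)⁆

/-- The Iwasawa subalgebra `𝔟 = 𝔞 ⊕ 𝔫` of `𝔰𝔲(1, n-1)`: the real Lie subalgebra generated by
the `B_a^R = Re B_a` and `B_a^I = Im B_a`, `a = 1, …, n-1` (zero for `n = 1`). -/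
def iwasawa (m : ℕ) : LieSubalgebra ℝ (u1 m) :=
  LieSubalgebra.lieSpan ℝ (u1 m)
    ((Set.range fun a : Fin m => rePart (Bmat a)) ∪ Set.range fun a : Fin m => imPart (Bmat a))

/-- `B_a^R` -/
def BR {m : ℕ} (a : Fin m) : iwasawa m :=
  ⟨rePart (Bmat a), LieSubalgebra.subset_lieSpan (Or.inl ⟨a, rfl⟩)⟩

/-- `B_a^I` -/
def BI {m : ℕ} (a : Fin m) : iwasawa m :=
  ⟨imPart (Bmat a), LieSubalgebra.subset_lieSpan (Or.inr ⟨a, rfl⟩)⟩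

/-! ### The Heisenberg algebra and `𝔩 = 𝔟 ⋉ 𝔥𝔢𝔦𝔰_{2n+1}` -/

/-- `ω(v, v') = Im (v̄_0 v'_0) - ∑ₐ Im (v̄_a v'_a)` on `ℂ^n`. -/
def symp {m : ℕ} (v v' : Fin (m + 1) → ℂ) : ℝ :=
  (conj (v 0) * v' 0).im - ∑ a : Fin m, (conj (v a.succ) * v' a.succ).im

/-- `𝔥𝔢𝔦𝔰_{2n+1} = ℂ^n ⊕ ℝ Z`; the basis `e_k, f_k` of `ℝ^{2n} = ℂ^n` is `e_k`, `i e_k`. -/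
structure Heis (m : ℕ) where
  /-- The component in `ℂ^n`. -/
  vec : Fin (m + 1) → ℂ
  /-- The coefficient of `Z`. -/
  cen : ℝ

namespace Heis

variable {m : ℕ}

/-- The underlying vector space is `ℂ^n × ℝ`. -/
def toProd : Heis m ≃ (Fin (m + 1) → ℂ) × ℝ where
  toFun x := (x.vec, x.cen)
  invFun x := ⟨x.1, x.2⟩
  left_inv _ := rfl
  right_inv _ := rfl

instance : AddCommGroup (Heis m) := toProd.addCommGroup
instance : Module ℝ (Heis m) := toProd.module ℝ

@[ext] theorem ext {x y : Heis m} (h₁ : x.vec = y.vec) (h₂ : x.cen = y.cen) : x = y := by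
  cases x; cases y; simp_all

@[simp] theorem vec_add (x y : Heis m) : (x + y).vec = x.vec + y.vec := rfl
@[simp] theorem cen_add (x y : Heis m) : (x + y).cen = x.cen + y.cen := rfl
@[simp] theorem vec_sub (x y : Heis m) : (x - y).vec = x.vec - y.vec := rfl
@[simp] theorem cen_sub (x y : Heis m) : (x - y).cen = x.cen - y.cen := rfl
@[simp] theorem vec_zero : (0 : Heis m).vec = 0 := rfl
@[simp] theorem cen_zero : (0 : Heis m).cen = 0 := rfl
@[simp] theorem vec_smul (t : ℝ) (x : Heis m) : (t • x).vec = t • x.vec := rfl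
@[simp] theorem cen_smul (t : ℝ) (x : Heis m) : (t • x).cen = t • x.cen := rfl

/-- `[v + s Z, v' + s' Z] = ω(v, v') Z`, that is `[e_0, f_0] = Z`, `[e_a, f_a] = -Z`. -/
instance : Bracket (Heis m) (Heis m) where
  bracket x y := ⟨0, symp x.vec y.vec⟩

@[simp] theorem vec_lie (x y : Heis m) : ⁅x, y⁆.vec = 0 := rfl
@[simp] theorem cen_lie (x y : Heis m) : ⁅x, y⁆.cen = symp x.vec y.vec := rfl

end Heis

theorem symp_add_left {m : ℕ} (u v w : Fin (m + 1) → ℂ) :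
    symp (u + v) w = symp u w + symp v w := by
  simp only [symp, Pi.add_apply, map_add, add_mul, Complex.add_im, Finset.sum_add_distrib]
  ring

theorem symp_add_right {m : ℕ} (u v w : Fin (m + 1) → ℂ) :
    symp u (v + w) = symp u v + symp u w := by
  simp only [symp, Pi.add_apply, mul_add, Complex.add_im, Finset.sum_add_distrib]
  ring

theorem symp_smul_right {m : ℕ} (t : ℝ) (v w : Fin (m + 1) → ℂ) :
    symp v (t • w) = t * symp v w := by
  have h : ∀ z z' : ℂ, (conj z * (t • z')).im = t * (conj z * z').im := by
    intro z z'; simp; ring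
  simp only [symp, Pi.smul_apply, h, mul_sub, Finset.mul_sum]

theorem symp_self {m : ℕ} (v : Fin (m + 1) → ℂ) : symp v v = 0 := by
  have h : ∀ z : ℂ, (conj z * z).im = 0 := by intro z; simp; ring
  simp [symp, h]

@[simp] theorem symp_zero_right {m : ℕ} (v : Fin (m + 1) → ℂ) : symp v 0 = 0 := by
  simp [symp]

@[simp] theorem symp_zero_left {m : ℕ} (v : Fin (m + 1) → ℂ) : symp 0 v = 0 := by
  simp [symp]

instance (m : ℕ) : LieRing (Heis m) where
  add_lie x y z := by ext <;> simp [symp_add_left]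
  lie_add x y z := by ext <;> simp [symp_add_right]
  lie_self x := by ext <;> simp [symp_self]
  leibniz_lie x y z := by ext <;> simp

instance (m : ℕ) : LieAlgebra ℝ (Heis m) where
  lie_smul t x y := by ext <;> simp [symp_smul_right]

theorem u1_apply {m : ℕ} (A : u1 m) (i j : Fin (m + 1)) :
    conj (A.1 j i) = -((if i = 0 then -1 else 1) * (if j = 0 then -1 else 1) * A.1 i j) := by
  have h : sigma A.1 = A.1 := A.2
  conv_rhs => rw [← h]
  simp only [sigma, signMat, Matrix.neg_apply, Matrix.mul_diagonal, Matrix.diagonal_mul,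
    Matrix.conjTranspose_apply]
  split_ifs <;> simp

/-- The form `ω` is invariant under `v ↦ -Aᵀ v` for `A ∈ 𝔲(1, n-1)`. -/
theorem symp_invariant {m : ℕ} (A : u1 m) (v w : Fin (m + 1) → ℂ) :
    symp (-(A.1.transpose.mulVec v)) w + symp v (-(A.1.transpose.mulVec w)) = 0 := by
  have key : ∀ v w : Fin (m + 1) → ℂ, symp v w =
      (∑ k : Fin (m + 1), (if k = 0 then (-1 : ℂ) else 1) * (-(conj (v k) * w k))).im := by
    intro v w
    simp [symp, Fin.sum_univ_succ]
    ring
  rw [key, key, ← Complex.add_im]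
  have hz : (∑ k : Fin (m + 1), (if k = 0 then (-1 : ℂ) else 1) *
        (-(conj ((-(A.1.transpose.mulVec v)) k) * w k))) +
      (∑ k : Fin (m + 1), (if k = 0 then (-1 : ℂ) else 1) *
        (-(conj (v k) * (-(A.1.transpose.mulVec w)) k))) = 0 := by
    simp only [Matrix.mulVec, dotProduct, Pi.neg_apply, Matrix.transpose_apply, map_neg, map_sum,
      map_mul, neg_mul, mul_neg, neg_neg, Finset.mul_sum, Finset.sum_mul]
    nth_rewrite 2 [Finset.sum_comm]
    rw [← Finset.sum_add_distrib]
    refine Finset.sum_eq_zero fun k _ => ?_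
    rw [← Finset.sum_add_distrib]
    refine Finset.sum_eq_zero fun j _ => ?_
    rw [u1_apply A k j]
    split_ifs <;> ring
  rw [hz]; simp

/-- The derivation of `𝔥𝔢𝔦𝔰_{2n+1}` by which `A ∈ 𝔲(1, n-1)` acts: `[A, v] = -Aᵀ v` for `v ∈ ℂ^n`
and `[A, Z] = 0`. -/
def heisDer {m : ℕ} (A : u1 m) : LieDerivation ℝ (Heis m) (Heis m) where
  toFun x := ⟨-(A.1.transpose.mulVec x.vec), 0⟩
  map_add' x y := by ext <;> simp [Matrix.mulVec_add]; ring
  map_smul' t x := by ext <;> simp [Matrix.mulVec_smul]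
  leibniz' x y := by
    ext
    · simp
    · have h := symp_invariant A x.vec y.vec
      have h₁ := symp_self (-(A.1.transpose.mulVec x.vec) + y.vec)
      rw [symp_add_left, symp_add_right, symp_add_right, symp_self, symp_self] at h₁
      simp only [LinearMap.coe_mk, AddHom.coe_mk, Heis.cen_sub, Heis.cen_lie]
      linarith

@[simp] theorem heisDer_vec {m : ℕ} (A : u1 m) (x : Heis m) :
    (heisDer A x).vec = -(A.1.transpose.mulVec x.vec) := rfl

@[simp] theorem heisDer_cen {m : ℕ} (A : u1 m) (x : Heis m) : (heisDer A x).cen = 0 := rfl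

/-- The action of `𝔲(1, n-1)` on `𝔥𝔢𝔦𝔰_{2n+1}` by derivations. -/
def heisAction (m : ℕ) : u1 m →ₗ⁅ℝ⁆ LieDerivation ℝ (Heis m) (Heis m) where
  toFun := heisDer
  map_add' A B := by
    ext x
    · simp [Matrix.add_mulVec]; ring
    · simp
  map_smul' t A := by
    ext x
    · simp [Matrix.smul_mulVec]
    · simp
  map_lie' {A B} := by
    have h : (⁅A, B⁆ : u1 m).1 = A.1 * B.1 - B.1 * A.1 := rfl
    ext x k
    · rw [LieDerivation.commutator_apply, heisDer_vec, h, Heis.vec_sub]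
      simp only [heisDer_vec, Matrix.transpose_sub, Matrix.transpose_mul, Matrix.sub_mulVec,
        Matrix.mulVec_neg, Matrix.mulVec_mulVec, neg_neg, Pi.neg_apply, Pi.sub_apply]
      ring
    · rw [LieDerivation.commutator_apply, Heis.cen_sub]; simp

/-- `𝔩 = 𝔟 ⋉ 𝔥𝔢𝔦𝔰_{2n+1}` -/
abbrev LieL (m : ℕ) : Type :=
  LieAlgebra.SemiDirectSum (Heis m) (iwasawa m) ((heisAction m).comp (iwasawa m).incl)

/-- `e_k` -/
def eVec {m : ℕ} (k : Fin (m + 1)) : LieL m := ⟨⟨Pi.single k 1, 0⟩, 0⟩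

/-- `f_k` -/
def fVec {m : ℕ} (k : Fin (m + 1)) : LieL m := ⟨⟨Pi.single k Complex.I, 0⟩, 0⟩

/-- `Z` -/
def Zvec (m : ℕ) : LieL m := ⟨⟨0, 1⟩, 0⟩

/-- The ordered family
`𝓑_n = (B_1^R, B_1^I, …, B_{n-1}^R, B_{n-1}^I, e_0, f_0, …, e_{n-1}, f_{n-1}, Z)`. -/
def basisB (m : ℕ) (i : Fin (4 * m + 3)) : LieL m :=
  if h : i.val < 2 * m then
    ⟨0, if i.val % 2 = 0 then BR ⟨i.val / 2, by omega⟩ else BI ⟨i.val / 2, by omega⟩⟩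
  else if h' : i.val < 4 * m + 2 then
    if i.val % 2 = 0 then eVec ⟨i.val / 2 - m, by omega⟩ else fVec ⟨i.val / 2 - m, by omega⟩
  else Zvec m

/-! ### The infinitesimal action of `𝔩` on the hypersurface -/

/-- The multiplier `A_00 + ∑ₐ A_0a X^a`. -/
def multiplier {m : ℕ} (A : Matrix (Fin (m + 1)) (Fin (m + 1)) ℂ) (X : Fin m → ℂ) : ℂ :=
  A 0 0 + ∑ a : Fin m, A 0 a.succ * X a

/-- The vector field `α(x)` on the hypersurface by which `x = A + v + s Z ∈ 𝔩` acts
infinitesimally, where `A ∈ 𝔟 ⊆ 𝔲(1, n-1)`, `v ∈ ℂ^n`, `s ∈ ℝ`. With `μ = A_00 + ∑_b A_0b X^b`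
its components are
* `Ẋ^a = A_a0 + ∑_b A_ab X^b - μ X^a`,
* `φ̃' = -2c Im μ + √2 ω(v, w) + s`,
* `ẇ = -Aᵀ w + v / (2√2)`.

Complex-linear extension in `x` gives the fields
`Y_a = α(U_a) = ∂_{X̄^a} - X^a ∑_b X^b ∂_{X^b} - w^0 ∂_{w^a} - w̄^a ∂_{w̄^0} + i c X^a ∂_φ̃`,
`V_0 = α(e_0 - i f_0) = (∂_{w^0} + 2 i w̄^0 ∂_φ̃) / √2`,
`V_a = α(e_a - i f_a) = (∂_{w^a} - 2 i w̄^a ∂_φ̃) / √2` and `α(Z) = ∂_φ̃`. -/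
def infAction {m : ℕ} (c : ℝ) (x : LieL m) (p : Coord m) : Coord m :=
  let A : Matrix (Fin (m + 1)) (Fin (m + 1)) ℂ := x.right.1.1
  let v : Fin (m + 1) → ℂ := x.left.vec
  let s : ℝ := x.left.cen
  let μ : ℂ := multiplier A p.1
  (fun a => A a.succ 0 + ∑ b : Fin m, A a.succ b.succ * p.1 b - μ * p.1 a,
    -2 * c * μ.im + √2 * symp v p.2.2 + s,
    -(A.transpose.mulVec p.2.2) + (1 / (2 * √2)) • v)

/-! ### The matrices -/

/-- The principal Ricci curvature `r_1`. -/
def r1 (n ρ c : ℝ) : ℝ :=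
  (-2 * (n + 2) * ρ ^ 2 - 4 * (n + 2) * c * ρ - 6 * c ^ 2) / ((ρ + c) * (ρ + 2 * c))

/-- The principal Ricci curvature `r_2`. -/
def r2 (n ρ c : ℝ) : ℝ :=
  (2 * n * ρ ^ 4 + (12 * n - 8) * c * ρ ^ 3 + (28 * n - 26) * c ^ 2 * ρ ^ 2
    + 32 * (n - 1) * c ^ 3 * ρ + 16 * (n - 1) * c ^ 4) / ((ρ + c) * (ρ + 2 * c) ^ 3)

/-- The principal Ricci curvature `r_3`. -/
def r3 (n ρ c : ℝ) : ℝ :=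
  2 * ((-ρ ^ 3 + (2 * n - 3) * c * ρ ^ 2 + (8 * n - 8) * c ^ 2 * ρ + (8 * n - 8) * c ^ 3)
    / (ρ + 2 * c) ^ 3)

/-- The principal Ricci curvature `r_4`. -/
def r4 (ρ c : ℝ) : ℝ := -(2 * (ρ + 3 * c) / (ρ + 2 * c))

/-- The Gram matrix for `n = m + 1 > 1`. The diagonal has entries `(ρ+c)/ρ`,
`(ρ+c)³/(ρ²(ρ+2c))`, then `(ρ+c)/(4ρ)` (`2n-4` times), `(ρ+2c)/(4ρ²)` (twice), `1/(4ρ)`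
(`2n-2` times) and `(ρ+c)/(4ρ²(ρ+2c))`; to it one adds `-(c/(2ρ²)) ((ρ+c)/(ρ+2c))` times
`E_{2,4n-1} + E_{4n-1,2}`. -/
def gramMatrix (m : ℕ) (ρ c : ℝ) : Matrix (Fin (4 * m + 3)) (Fin (4 * m + 3)) ℝ :=
  Matrix.diagonal (fun i =>
    if i.val = 0 then (ρ + c) / ρ
    else if i.val = 1 then (ρ + c) ^ 3 / (ρ ^ 2 * (ρ + 2 * c))
    else if i.val < 2 * m then (ρ + c) / (4 * ρ)
    else if i.val < 2 * m + 2 then (ρ + 2 * c) / (4 * ρ ^ 2)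
    else if i.val < 4 * m + 2 then 1 / (4 * ρ)
    else 1 / (4 * ρ ^ 2) * ((ρ + c) / (ρ + 2 * c)))
  - (c / (2 * ρ ^ 2) * ((ρ + c) / (ρ + 2 * c))) •
    (Matrix.single 1 (Fin.last (4 * m + 2)) 1 + Matrix.single (Fin.last (4 * m + 2)) 1 1)

/-- The matrix `diag(r_1 𝟙_{2n-2}, r_3 𝟙_2, r_4 𝟙_{2n-2}, r_2) + 2c (r_1 - r_2) E_{4n-1,2}`,
`n = m + 1`. -/
def ricciMatrix (m : ℕ) (ρ c : ℝ) : Matrix (Fin (4 * m + 3)) (Fin (4 * m + 3)) ℝ :=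
  let n : ℝ := m + 1
  Matrix.diagonal (fun i =>
    if i.val < 2 * m then r1 n ρ c
    else if i.val < 2 * m + 2 then r3 n ρ c
    else if i.val < 4 * m + 2 then r4 ρ c
    else r2 n ρ c)
  + (2 * c * (r1 n ρ c - r2 n ρ c)) • Matrix.single (Fin.last (4 * m + 2)) 1 1

end OneLoop

end

/-!
Both sides of every identity live at the single point `p_ρ`, the origin of the coordinates
`(X, φ̃, w)`, so only the second order Taylor expansion of the metric at the origin matters.

For any metric `g` on a vector space, differentiating `g (Γ (u, v), t) = Γ (u, v; t)` expresses the
curvature tensor through the derivatives of `g` up to order two (`metric_curvatureEnd`), and the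
Ricci tensor is a sum over a `g`-orthogonal basis (`ricci_eq_sum`). With
`Ω(p, v) = -4 Im (w̄^0 z^0 - ∑ₐ w̄^a z^a) + 2c Im ∑ₐ X̄^a Y^a` the metric is, up to terms of third order,
`λ ((1 + |X|²) |dX|² + |X̄ dX|²) + β (dφ̃ + Ω(p, ·))² - ν (|dw^0|² - ∑ₐ |dw^a|²)`
`+ κ (1 + |X|²) |dw^0 + ∑ₐ X^a dw^a|²`,
where `λ, β, ν, κ` are `coeffX`, `coeffPhi`, `coeffW` and `coeffU` (`hasJet_gmet`). At the origin it
is diagonal in the real coordinates, and `Γ(b, b) = 0` for every coordinate vector `b`, which removes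
one of the two quadratic terms of the curvature. The remaining contributions of the coordinate
directions to `Ric(v, v)` are computed in pairs, a real direction with its multiple by `i`
(`ricciTerm_vecX`, `ricciTerm_vecPhi`, `ricciTerm_vecW_zero`, `ricciTerm_vecW_succ`); their sum
involves only `|Y|²`, `ψ²`, `|z^0|²` and `∑ₐ |z^a|²` for `v = (Y, ψ, z)`. By polarization the Ricci
endomorphism is diagonal in the coordinates, with eigenvalues `r_1`, `r_2`, `r_3`, `r_4`
(`ricciEnd_gmet_zero`).

On the algebraic side, `𝔟` is contained in an explicit Lie algebra of matrices which are determined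
by their first column (`iwasawa_le_model`, `eq_zero_of_mem_iwasawa`), and the first columns of the
`B_a^R` and `B_a^I` are real multiples of the `a`-th standard vector and of `i` times it. Hence
`α_ρ` is bijective, and it maps `𝓑_n` to a rescaled coordinate basis, except that `B_1^I` gets the
additional component `-2c ∂_φ̃` because its entry at `(0, 0)` is `i` (`alpha_basisB`). This component
is the source of the off-diagonal entries of both matrices.
-/

open scoped Topology

noncomputable section

namespace OneLoop

attribute [local instance] LieRing.ofAssociativeRing

/-! ### The curvature in terms of the second order Taylor expansion of the metric -/

section Jet

variable {V : Type*} [NormedAddCommGroup V] [NormedSpace ℝ V]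
  {g : V → V →L[ℝ] V →L[ℝ] ℝ} {x : V}

theorem fderiv_metric_symm (hg : DifferentiableAt ℝ g x) (hsymm : ∀ y v w, g y v w = g y w v)
    (a v w : V) : fderiv ℝ g x a v w = fderiv ℝ g x a w v := by
  have h : ∀ v w, fderiv ℝ g x a v w = fderiv ℝ (fun y => g y v w) x a := fun v w => by
    rw [fderiv_clm_apply (hg.clm_apply (differentiableAt_const v)) (differentiableAt_const w),
      fderiv_clm_apply hg (differentiableAt_const v)]
    simp
  rw [h, h]; simp_rw [hsymm _ v w]

variable (V) in
/-- The linear map which sends the first derivative of a metric to the Christoffel symbols of the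
first kind. -/
def christoffelOfDeriv :
    (V →L[ℝ] V →L[ℝ] V →L[ℝ] ℝ) →L[ℝ] (V →L[ℝ] V →L[ℝ] V →L[ℝ] ℝ) :=
  let Fl : (V →L[ℝ] V →L[ℝ] V →L[ℝ] ℝ) →L[ℝ] (V →L[ℝ] V →L[ℝ] V →L[ℝ] ℝ) :=
    (ContinuousLinearMap.flipₗᵢ ℝ V V (V →L[ℝ] ℝ)).toContinuousLinearEquiv.toContinuousLinearMap
  (1 / 2 : ℝ) • (ContinuousLinearMap.id ℝ _ + Fl
    - (ContinuousLinearMap.compL ℝ V (V →L[ℝ] V →L[ℝ] ℝ) (V →L[ℝ] V →L[ℝ] ℝ)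
        (ContinuousLinearMap.flipₗᵢ ℝ V V ℝ).toContinuousLinearEquiv.toContinuousLinearMap) ∘L Fl)

theorem christoffelOfDeriv_apply (T : V →L[ℝ] V →L[ℝ] V →L[ℝ] ℝ) (u v t : V) :
    christoffelOfDeriv V T u v t = (1 / 2) * (T u v t + T v u t - T t u v) := by
  simp [christoffelOfDeriv]

theorem hasFDerivAt_christoffelFirst (hg : ContDiffAt ℝ 2 g x) :
    HasFDerivAt (christoffelFirst g) (christoffelOfDeriv V ∘L fderiv ℝ (fderiv ℝ g) x) x := by
  have hP : christoffelFirst g = christoffelOfDeriv V ∘ fderiv ℝ g := by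
    ext y u v w; simp [christoffelFirst_apply, christoffelOfDeriv_apply]
  have hd : DifferentiableAt ℝ (fderiv ℝ g) x :=
    (hg.fderiv_right (m := 1) (by norm_num)).differentiableAt (by norm_num)
  rw [hP]
  exact (christoffelOfDeriv V).hasFDerivAt.comp x hd.hasFDerivAt

/-- The Christoffel symbols are obtained from those of the first kind by solving
`g (Γ (u, v), t) = Γ (u, v; t)`. -/
theorem christoffel_spec (hx : (g x).IsInvertible) (u v t : V) :
    g x (christoffel g x u v) t = christoffelFirst g x u v t := by
  simp [christoffel, hx.self_apply_inverse]

theorem christoffel_eq (hx : (g x).IsInvertible) {u v z : V}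
    (h : ∀ t, g x z t = christoffelFirst g x u v t) : christoffel g x u v = z := by
  have : christoffelFirst g x u v = g x z := by ext t; rw [h]
  simp [christoffel, this, hx.inverse_apply_self]

/-- The derivative of the Christoffel symbols, with the index lowered again. -/
theorem fderiv_christoffel [CompleteSpace V] (hg : ContDiffAt ℝ 2 g x) (hx : (g x).IsInvertible) (a u v t : V) :
    g x (fderiv ℝ (christoffel g) x a u v) t =
      fderiv ℝ (christoffelFirst g) x a u v t - fderiv ℝ g x a (christoffel g x u v) t := by
  have hd := hg.differentiableAt (by norm_num)
  have hΓ₁ := (hasFDerivAt_christoffelFirst hg).differentiableAt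
  obtain ⟨e, he⟩ := hx
  have hΓ : DifferentiableAt ℝ (christoffel g) x := by
    have hi : DifferentiableAt ℝ (fun y => (g y).inverse) x := by
      have := (contDiffAt_map_inverse (n := 1) e).differentiableAt (by norm_num)
      rw [he] at this
      exact this.comp x hd
    unfold christoffel
    fun_prop
  have hev : ∀ᶠ y in 𝓝 x, (g y).IsInvertible :=
    hd.continuousAt.eventually (he ▸ ContinuousLinearEquiv.nhds e)
  -- differentiate the defining equation of `Γ`, which holds in a neighbourhood of `x`
  have heq : (fun y => g y (christoffel g y u v) t) =ᶠ[𝓝 x] fun y => christoffelFirst g y u v t :=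
    hev.mono fun y hy => christoffel_spec hy u v t
  have h := DFunLike.congr_fun (heq.fderiv_eq (𝕜 := ℝ)) a
  have hΓu := hΓ.clm_apply (differentiableAt_const u)
  have hΓuv := hΓu.clm_apply (differentiableAt_const v)
  have hΓ₁u := hΓ₁.clm_apply (differentiableAt_const u)
  rw [fderiv_clm_apply (hd.clm_apply hΓuv) (differentiableAt_const t),
    fderiv_clm_apply hd hΓuv, fderiv_clm_apply hΓu (differentiableAt_const v),
    fderiv_clm_apply hΓ (differentiableAt_const u),
    fderiv_clm_apply (hΓ₁u.clm_apply (differentiableAt_const v)) (differentiableAt_const t),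
    fderiv_clm_apply hΓ₁u (differentiableAt_const v),
    fderiv_clm_apply hΓ₁ (differentiableAt_const u)] at h
  simp at h
  linarith

/-- The curvature tensor with all indices down, for a metric whose second order Taylor expansion
is known. -/
theorem metric_curvatureEnd [CompleteSpace V] (hg : ContDiffAt ℝ 2 g x) (hx : (g x).IsInvertible)
    (hsymm : ∀ y v w, g y v w = g y w v) (u v w z : V) :
    g x (curvatureEnd g x v w u) z =
      (1 / 2) * (fderiv ℝ (fderiv ℝ g) x u w v z - fderiv ℝ (fderiv ℝ g) x u z v w
        - fderiv ℝ (fderiv ℝ g) x v w u z + fderiv ℝ (fderiv ℝ g) x v z u w)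
      - g x (christoffel g x u z) (christoffel g x v w)
      + g x (christoffel g x v z) (christoffel g x u w) := by
  have hD : fderiv ℝ (fderiv ℝ g) x u v = fderiv ℝ (fderiv ℝ g) x v u :=
    (hg.isSymmSndFDerivAt (by simp)) u v
  have hd := hg.differentiableAt (by norm_num)
  -- the connection is metric: `∂_a g (b, z) = g (Γ (a, b), z) + g (b, Γ (a, z))`
  have key : ∀ a b, fderiv ℝ g x a b z
      = christoffelFirst g x a b z + christoffelFirst g x a z b := fun a b => by
    rw [christoffelFirst_apply, christoffelFirst_apply, fderiv_metric_symm hd hsymm a z b,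
      fderiv_metric_symm hd hsymm z a b, fderiv_metric_symm hd hsymm b a z]
    ring
  have hc : ∀ a b d, g x (christoffel g x a b) d = christoffelFirst g x a b d :=
    christoffel_spec hx
  simp only [curvatureEnd, LinearMap.coe_mk, AddHom.coe_mk, map_add, map_sub,
    add_apply, sub_apply, fderiv_christoffel hg hx,
    (hasFDerivAt_christoffelFirst hg).fderiv, ContinuousLinearMap.comp_apply,
    christoffelOfDeriv_apply, hc, key, hD]
  ring

theorem trace_eq_sum_of_orthogonal {ι : Type*} [Fintype ι] (b : Module.Basis ι ℝ V)
    (B : V →L[ℝ] V →L[ℝ] ℝ) (ho : ∀ i j, i ≠ j → B (b i) (b j) = 0) (hn : ∀ i, B (b i) (b i) ≠ 0)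
    (L : V →ₗ[ℝ] V) :
    LinearMap.trace ℝ V L = ∑ i, B (L (b i)) (b i) / B (b i) (b i) := by
  classical
  rw [LinearMap.trace_eq_matrix_trace ℝ b, Matrix.trace]
  refine Finset.sum_congr rfl fun i _ => ?_
  rw [eq_div_iff (hn i), Matrix.diag_apply, LinearMap.toMatrix_apply]
  conv_rhs => rw [← b.sum_repr (L (b i))]
  rw [map_sum, sum_apply, Finset.sum_eq_single i]
  · simp
  · intro j _ hj; simp [ho j i hj]
  · simp

/-- The Ricci tensor as a sum over a `g`-orthogonal basis consisting of vectors with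
`Γ (b i, b i) = 0`. -/
theorem ricci_eq_sum [CompleteSpace V] {ι : Type*} [Fintype ι] (b : Module.Basis ι ℝ V)
    (hg : ContDiffAt ℝ 2 g x) (hx : (g x).IsInvertible) (hsymm : ∀ y v w, g y v w = g y w v)
    (ho : ∀ i j, i ≠ j → g x (b i) (b j) = 0) (hn : ∀ i, g x (b i) (b i) ≠ 0)
    (hΓ : ∀ i, christoffel g x (b i) (b i) = 0) (v w : V) :
    ricci g x v w = ∑ i, ((1 / 2) *
      (fderiv ℝ (fderiv ℝ g) x (b i) w v (b i) - fderiv ℝ (fderiv ℝ g) x (b i) (b i) v w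
        - fderiv ℝ (fderiv ℝ g) x v w (b i) (b i) + fderiv ℝ (fderiv ℝ g) x v (b i) (b i) w)
      + g x (christoffel g x v (b i)) (christoffel g x (b i) w)) / g x (b i) (b i) := by
  change LinearMap.trace ℝ V (curvatureEnd g x v w) = _
  rw [trace_eq_sum_of_orthogonal b (g x) ho hn]
  refine Finset.sum_congr rfl fun i _ => ?_
  rw [metric_curvatureEnd hg hx hsymm, hΓ]
  simp

theorem ricciEnd_eq [FiniteDimensional ℝ V] (hx : (g x).IsInvertible) {v z : V} (h : ∀ t, g x z t = ricci g x v t) :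
    ricciEnd g x v = z := by
  have : LinearMap.toContinuousLinearMap (ricci g x v) = g x z := by ext t; simp [h]
  simp [ricciEnd, this, hx.inverse_apply_self]

end Jet

/-! ### Second order jets of real functions at the origin -/

section RealJet

variable {V : Type*} [NormedAddCommGroup V] [NormedSpace ℝ V]

/-- `f` is twice continuously differentiable near `0` and has there the value `a`, the first
derivative `l` and the second derivative `q`. -/
structure HasJet (f : V → ℝ) (a : ℝ) (l : V → ℝ) (q : V → V → ℝ) : Prop where
  contDiffAt : ContDiffAt ℝ 2 f 0
  value : f 0 = a
  first : ∀ u, fderiv ℝ f 0 u = l u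
  second : ∀ u v, fderiv ℝ (fderiv ℝ f) 0 u v = q u v

namespace HasJet

variable {f h : V → ℝ} {a b : ℝ} {l k : V → ℝ} {q r : V → V → ℝ}

theorem differentiableAt_fderiv {F : Type*} [NormedAddCommGroup F] [NormedSpace ℝ F] {f : V → F}
    {x : V} (hf : ContDiffAt ℝ 2 f x) : DifferentiableAt ℝ (fderiv ℝ f) x :=
  (hf.fderiv_right (m := 1) (by norm_num)).differentiableAt (by norm_num)

theorem eventually_differentiableAt {F : Type*} [NormedAddCommGroup F] [NormedSpace ℝ F]
    {f : V → F} {x : V} (hf : ContDiffAt ℝ 2 f x) : ∀ᶠ y in 𝓝 x, DifferentiableAt ℝ f y :=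
  (hf.eventually (by simp)).mono fun _ hy => hy.differentiableAt (by norm_num)

theorem of_contDiffAt (hf : ContDiffAt ℝ 2 f 0) :
    HasJet f (f 0) (fderiv ℝ f 0) (fun u v => fderiv ℝ (fderiv ℝ f) 0 u v) :=
  ⟨hf, rfl, fun _ => rfl, fun _ _ => rfl⟩

theorem congr (hf : HasJet f a l q) (e : f =ᶠ[𝓝 0] h) : HasJet h a l q where
  contDiffAt := hf.contDiffAt.congr_of_eventuallyEq e.symm
  value := by rw [← e.eq_of_nhds, hf.value]
  first u := by rw [← e.fderiv_eq, hf.first]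
  second u v := by rw [← e.fderiv.fderiv_eq, hf.second]

theorem const (a : ℝ) : HasJet (fun _ : V => a) a (fun _ => 0) (fun _ _ => 0) where
  contDiffAt := contDiffAt_const
  value := rfl
  first u := by simp
  second u v := by simp

theorem clm (L : V →L[ℝ] ℝ) : HasJet L 0 L (fun _ _ => 0) where
  contDiffAt := L.contDiff.contDiffAt
  value := by simp
  first u := by simp
  second u v := by
    have : fderiv ℝ L = fun _ => L := by ext1 x; exact L.fderiv
    rw [this]; simp

theorem add (hf : HasJet f a l q) (hh : HasJet h b k r) :
    HasJet (fun x => f x + h x) (a + b) (fun u => l u + k u) (fun u v => q u v + r u v) where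
  contDiffAt := hf.contDiffAt.add hh.contDiffAt
  value := by simp [hf.value, hh.value]
  first u := by
    rw [fderiv_fun_add (hf.contDiffAt.differentiableAt (by norm_num))
      (hh.contDiffAt.differentiableAt (by norm_num))]
    simp [hf.first, hh.first]
  second u v := by
    have e : fderiv ℝ (fun x => f x + h x) =ᶠ[𝓝 0] fun x => fderiv ℝ f x + fderiv ℝ h x := by
      filter_upwards [eventually_differentiableAt hf.contDiffAt,
        eventually_differentiableAt hh.contDiffAt] with x h₁ h₂
      exact fderiv_fun_add h₁ h₂
    rw [e.fderiv_eq, fderiv_fun_add (differentiableAt_fderiv hf.contDiffAt)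
      (differentiableAt_fderiv hh.contDiffAt)]
    simp [hf.second, hh.second]

theorem mul (hf : HasJet f a l q) (hh : HasJet h b k r) :
    HasJet (fun x => f x * h x) (a * b) (fun u => a * k u + b * l u)
      (fun u v => a * r u v + b * q u v + l u * k v + k u * l v) where
  contDiffAt := hf.contDiffAt.mul hh.contDiffAt
  value := by simp [hf.value, hh.value]
  first u := by
    rw [fderiv_fun_mul (hf.contDiffAt.differentiableAt (by norm_num))
      (hh.contDiffAt.differentiableAt (by norm_num))]
    simp [hf.first, hh.first, hf.value, hh.value]
  second u v := by
    have e : fderiv ℝ (fun x => f x * h x)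
        =ᶠ[𝓝 0] fun x => f x • fderiv ℝ h x + h x • fderiv ℝ f x := by
      filter_upwards [eventually_differentiableAt hf.contDiffAt,
        eventually_differentiableAt hh.contDiffAt] with x h₁ h₂
      exact fderiv_fun_mul h₁ h₂
    have df := hf.contDiffAt.differentiableAt (by norm_num)
    have dh := hh.contDiffAt.differentiableAt (by norm_num)
    have df' := differentiableAt_fderiv hf.contDiffAt
    have dh' := differentiableAt_fderiv hh.contDiffAt
    rw [e.fderiv_eq, fderiv_fun_add (df.fun_smul dh') (dh.fun_smul df'), fderiv_fun_smul df dh',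
      fderiv_fun_smul dh df']
    simp [hf.first, hh.first, hf.value, hh.value, hf.second, hh.second]
    ring

theorem const_mul (c : ℝ) (hf : HasJet f a l q) :
    HasJet (fun x => c * f x) (c * a) (fun u => c * l u) (fun u v => c * q u v) := by
  simpa using (const c).mul hf

theorem sum {ι : Type*} (s : Finset ι) {f : ι → V → ℝ} {a : ι → ℝ} {l : ι → V → ℝ}
    {q : ι → V → V → ℝ} (hf : ∀ i, HasJet (f i) (a i) (l i) (q i)) :
    HasJet (fun x => ∑ i ∈ s, f i x) (∑ i ∈ s, a i) (fun u => ∑ i ∈ s, l i u)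
      (fun u v => ∑ i ∈ s, q i u v) := by
  classical
  induction s using Finset.induction_on with
  | empty => simpa using const (V := V) 0
  | insert i s hi ih => simpa [Finset.sum_insert hi] using (hf i).add ih

/-- The second derivative of `1 / f` at a critical point of `f` with critical value `1`. -/
theorem one_div (hf : HasJet f 1 (fun _ => 0) q) :
    HasJet (fun x => 1 / f x) 1 (fun _ => 0) (fun u v => -q u v) := by
  have h0 : f 0 ≠ 0 := by rw [hf.value]; exact one_ne_zero
  have hc : ContDiffAt ℝ 2 (fun x => 1 / f x) 0 := contDiffAt_const.div hf.contDiffAt h0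
  have e : (fun x => f x * (1 / f x)) =ᶠ[𝓝 0] fun _ => (1 : ℝ) := by
    filter_upwards [hf.contDiffAt.continuousAt.eventually_ne h0] with x hx
    exact mul_one_div_cancel hx
  -- compare the jets of both sides of `f * (1 / f) = 1`
  have hj := (hf.mul (of_contDiffAt hc)).congr e
  have h1 : ∀ u, fderiv ℝ (fun x => 1 / f x) 0 u = 0 := fun u => by
    simpa using (hj.first u).symm
  refine ⟨hc, by simp [hf.value], h1, fun u v => ?_⟩
  have h2 := hj.second u v
  simp only [hf.value] at h2
  simp at h2
  simp only [← _root_.one_div] at h2 ⊢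
  linarith

end HasJet

/-- The derivatives of a family of bilinear forms, from the jets of its coefficients. -/
theorem HasJet.of_clm_apply {g : V → V →L[ℝ] V →L[ℝ] ℝ} (hg : ContDiffAt ℝ 2 g 0) {v w : V} {a : ℝ}
    {l : V → ℝ} {q : V → V → ℝ} (h : HasJet (fun x => g x v w) a l q) :
    g 0 v w = a ∧ (∀ u, fderiv ℝ g 0 u v w = l u) ∧
      ∀ t u, fderiv ℝ (fderiv ℝ g) 0 t u v w = q t u := by
  let ev : (V →L[ℝ] V →L[ℝ] ℝ) →L[ℝ] ℝ :=
    (ContinuousLinearMap.apply ℝ ℝ w).comp (ContinuousLinearMap.apply ℝ (V →L[ℝ] ℝ) v)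
  have h1 : ∀ x, DifferentiableAt ℝ g x → fderiv ℝ (fun x => g x v w) x = ev ∘L fderiv ℝ g x :=
    fun x hx => (ev.hasFDerivAt.comp x hx.hasFDerivAt).fderiv
  refine ⟨h.value, fun u => ?_, fun t u => ?_⟩
  · rw [← h.first, h1 0 (hg.differentiableAt (by norm_num))]; rfl
  · have e : fderiv ℝ (fun x => g x v w) =ᶠ[𝓝 0] fun x => ev ∘L fderiv ℝ g x :=
      (HasJet.eventually_differentiableAt hg).mono h1
    have h2 : HasFDerivAt (fun x => ev ∘L fderiv ℝ g x)
        ((ContinuousLinearMap.compL ℝ V (V →L[ℝ] V →L[ℝ] ℝ) ℝ ev) ∘L fderiv ℝ (fderiv ℝ g) 0) 0 :=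
      (ContinuousLinearMap.compL ℝ V (V →L[ℝ] V →L[ℝ] ℝ) ℝ ev).hasFDerivAt.comp 0
        (HasJet.differentiableAt_fderiv hg).hasFDerivAt
    rw [← h.second, e.fderiv_eq, h2.fderiv]
    rfl

end RealJet

/-! ### The second order jet of the metric -/

section MetricJet

variable {m : ℕ}

/-- The Hermitian product `∑ₐ X̄^a Y^a`. -/
def hdot (X Y : Fin m → ℂ) : ℂ := ∑ a, conj (X a) * Y a

/-- The complex bilinear product `∑ₐ X^a Y^a`. -/
def bdot (X Y : Fin m → ℂ) : ℂ := ∑ a, X a * Y a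

/-- The components `(w^1, …, w^(n-1))` of `w = (w^0, …, w^(n-1))`. -/
def wTail (u : Coord m) (a : Fin m) : ℂ := u.2.2 a.succ

/-- The bilinear form `Ω(u, v) = -4 Im (w̄^0 z^0 - ∑ₐ w̄^a z^a) + 2c Im ∑ₐ X̄^a Y^a`, such that
`Ω(p, ·)` is the part of `theta c p` linear in `p`. -/
def Om (c : ℝ) (u v : Coord m) : ℝ :=
  -4 * ((conj (u.2.2 0) * v.2.2 0).im - (hdot (wTail u) (wTail v)).im) + 2 * c * (hdot u.1 v.1).im

/-- The coefficient of `|dX|²` in the metric at the origin. -/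
def coeffX (ρ c : ℝ) : ℝ := (ρ + c) / ρ

/-- The coefficient of `θ²`. -/
def coeffPhi (ρ c : ℝ) : ℝ := 1 / (4 * ρ ^ 2) * ((ρ + c) / (ρ + 2 * c))

/-- The coefficient of `|dw^a|²`, `a ≥ 1`. -/
def coeffW (ρ : ℝ) : ℝ := 2 / ρ

/-- The coefficient of `|dw^0 + ∑ₐ X^a dw^a|²`; that of `|dw^0|²` is `coeffU ρ c - coeffW ρ`. -/
def coeffU (ρ c : ℝ) : ℝ := (ρ + c) / ρ ^ 2 * 4

theorem hdot_add_left (X X' Y : Fin m → ℂ) : hdot (X + X') Y = hdot X Y + hdot X' Y := by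
  simp [hdot, add_mul, Finset.sum_add_distrib]

theorem hdot_add_right (X Y Y' : Fin m → ℂ) : hdot X (Y + Y') = hdot X Y + hdot X Y' := by
  simp [hdot, mul_add, Finset.sum_add_distrib]

theorem hdot_smul_left (z : ℂ) (X Y : Fin m → ℂ) : hdot (z • X) Y = conj z * hdot X Y := by
  simp [hdot, Finset.mul_sum, mul_assoc]

theorem hdot_smul_right (z : ℂ) (X Y : Fin m → ℂ) : hdot X (z • Y) = z * hdot X Y := by
  simp only [hdot, Finset.mul_sum, Pi.smul_apply, smul_eq_mul]
  exact Finset.sum_congr rfl fun a _ => by ring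

theorem hdot_star_left (X Y : Fin m → ℂ) : hdot (star X) Y = bdot X Y := by
  simp [hdot, bdot]

theorem bdot_comm (X Y : Fin m → ℂ) : bdot X Y = bdot Y X := by
  simp [bdot, mul_comm]

theorem hdot_conj (X Y : Fin m → ℂ) : hdot Y X = conj (hdot X Y) := by
  simp [hdot, mul_comm]

/-- The coefficients of the metric in terms of scalar expressions, whose jets can be computed. -/
theorem gmet_apply (ρ c : ℝ) (p v w : Coord m) :
    gmet m ρ c p v w =
      (ρ + c) / ρ * (1 / defect p) * ((hdot v.1 w.1).re + 1 / defect p *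
        ((hdot p.1 v.1).re * (hdot p.1 w.1).re + (hdot p.1 v.1).im * (hdot p.1 w.1).im))
      + 1 / (4 * ρ ^ 2) * ((ρ + c) / (ρ + 2 * c)) *
        ((v.2.1 + (-4 * ((conj (p.2.2 0) * v.2.2 0).im - (hdot (wTail p) (wTail v)).im)
            + 2 * c * (1 / defect p) * (hdot p.1 v.1).im)) *
          (w.2.1 + (-4 * ((conj (p.2.2 0) * w.2.2 0).im - (hdot (wTail p) (wTail w)).im)
            + 2 * c * (1 / defect p) * (hdot p.1 w.1).im)))
      - 2 / ρ * ((conj (v.2.2 0) * w.2.2 0).re - (hdot (wTail v) (wTail w)).re)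
      + (ρ + c) / ρ ^ 2 * 4 * (1 / defect p) *
        ((v.2.2 0 + bdot p.1 (wTail v)).re * (w.2.2 0 + bdot p.1 (wTail w)).re
          + (v.2.2 0 + bdot p.1 (wTail v)).im * (w.2.2 0 + bdot p.1 (wTail w)).im) := by
  simp [gmet, sqForm, absSqForm, dX, dw, dphi, theta, XdX, hdot, bdot, wTail,
    Finset.sum_add_distrib]
  ring

theorem gmet_symm (ρ c : ℝ) (p v w : Coord m) : gmet m ρ c p v w = gmet m ρ c p w v := by
  rw [gmet_apply, gmet_apply, hdot_conj w.1 v.1, hdot_conj (wTail w) (wTail v)]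
  simp only [Complex.conj_re, Complex.mul_re, Complex.conj_im]
  ring

theorem hasJet_linear {V : Type*} [NormedAddCommGroup V] [NormedSpace ℝ V] [FiniteDimensional ℝ V]
    {f : V → ℝ} (hf : IsLinearMap ℝ f) : HasJet f 0 f (fun _ _ => 0) :=
  HasJet.clm (LinearMap.toContinuousLinearMap hf.mk')

theorem isLinearMap_hdot_re (v : Coord m) : IsLinearMap ℝ fun p : Coord m => (hdot p.1 v.1).re := by
  constructor
  · intro x y; simp [hdot_add_left]
  · intro t x
    have : (t • x).1 = (t : ℂ) • x.1 := by ext; simp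
    rw [this, hdot_smul_left]; simp

theorem isLinearMap_hdot_im (v : Coord m) : IsLinearMap ℝ fun p : Coord m => (hdot p.1 v.1).im := by
  constructor
  · intro x y; simp [hdot_add_left]
  · intro t x
    have : (t • x).1 = (t : ℂ) • x.1 := by ext; simp
    rw [this, hdot_smul_left]; simp

theorem isLinearMap_bdot_re (Z : Fin m → ℂ) : IsLinearMap ℝ fun p : Coord m => (bdot p.1 Z).re := by
  constructor
  · intro x y; simp [bdot, add_mul, Finset.sum_add_distrib]
  · intro t x; simp [bdot, Finset.mul_sum, mul_assoc, mul_sub]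

theorem isLinearMap_bdot_im (Z : Fin m → ℂ) : IsLinearMap ℝ fun p : Coord m => (bdot p.1 Z).im := by
  constructor
  · intro x y; simp [bdot, add_mul, Finset.sum_add_distrib]
  · intro t x; simp [bdot, Finset.mul_sum, mul_assoc, mul_add]

theorem isLinearMap_Om_zero (v : Coord m) : IsLinearMap ℝ fun p : Coord m =>
    -4 * ((conj (p.2.2 0) * v.2.2 0).im - (hdot (wTail p) (wTail v)).im) := by
  constructor
  · intro x y
    have : wTail (x + y) = wTail x + wTail y := rfl
    simp [hdot_add_left, this]; ring
  · intro t x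
    have : wTail (t • x) = (t : ℂ) • wTail x := by ext; simp [wTail]
    rw [this, hdot_smul_left]; simp; ring

/-- As `1 / (1 - ‖X‖²) = 1 + ‖X‖² + O(‖X‖⁴)`. -/
theorem hasJet_inv_defect : HasJet (fun p : Coord m => 1 / defect p) 1 (fun _ => 0)
    (fun t u => 2 * (hdot t.1 u.1).re) := by
  have hlin : ∀ a : Fin m, IsLinearMap ℝ (fun p : Coord m => (p.1 a).re) ∧
      IsLinearMap ℝ (fun p : Coord m => (p.1 a).im) := fun a =>
    ⟨⟨fun x y => by simp, fun t x => by simp⟩, ⟨fun x y => by simp, fun t x => by simp⟩⟩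
  have h := (HasJet.const (V := Coord m) 1).add (HasJet.const_mul (-1)
    (HasJet.sum Finset.univ fun a : Fin m =>
      ((hasJet_linear (hlin a).1).mul (hasJet_linear (hlin a).1)).add
        ((hasJet_linear (hlin a).2).mul (hasJet_linear (hlin a).2))))
  have e : (fun p : Coord m => 1 + -1 * ∑ a : Fin m,
      ((p.1 a).re * (p.1 a).re + (p.1 a).im * (p.1 a).im)) = defect := by
    ext p; simp [defect, Complex.sq_norm, Complex.normSq_apply]; ring
  rw [e] at h
  simp only [zero_mul, mul_zero, add_zero, Finset.sum_const_zero] at h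
  have h' := h.one_div
  refine ⟨h'.contDiffAt, h'.value, h'.first, fun t u => ?_⟩
  rw [h'.second]
  simp only [hdot, Complex.re_sum, Finset.mul_sum]
  simp only [zero_add, neg_mul, one_mul, neg_neg, Finset.sum_neg_distrib]
  refine Finset.sum_congr rfl fun a _ => ?_
  simp; ring

/-- The second order jet of the coefficient `g(v, w)` of the metric. -/
theorem hasJet_gmet (ρ c : ℝ) (v w : Coord m) :
    HasJet (fun p => gmet m ρ c p v w)
      (coeffX ρ c * (hdot v.1 w.1).re + coeffPhi ρ c * (v.2.1 * w.2.1)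
        + (coeffU ρ c - coeffW ρ) * (conj (v.2.2 0) * w.2.2 0).re
        + coeffW ρ * (hdot (wTail v) (wTail w)).re)
      (fun u => coeffPhi ρ c * (v.2.1 * Om c u w + w.2.1 * Om c u v)
        + coeffU ρ c * (conj (v.2.2 0) * bdot u.1 (wTail w)
          + conj (w.2.2 0) * bdot u.1 (wTail v)).re)
      (fun t u => coeffX ρ c * (2 * (hdot t.1 u.1).re * (hdot v.1 w.1).re
          + (conj (hdot t.1 v.1) * hdot u.1 w.1 + conj (hdot u.1 v.1) * hdot t.1 w.1).re)
        + coeffPhi ρ c * (Om c t v * Om c u w + Om c u v * Om c t w)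
        + coeffU ρ c * (2 * (hdot t.1 u.1).re * (conj (v.2.2 0) * w.2.2 0).re
          + (conj (bdot t.1 (wTail v)) * bdot u.1 (wTail w)
            + conj (bdot u.1 (wTail v)) * bdot t.1 (wTail w)).re)) := by
  have e := hasJet_inv_defect (m := m)
  have re v := hasJet_linear (isLinearMap_hdot_re (m := m) v)
  have im v := hasJet_linear (isLinearMap_hdot_im (m := m) v)
  have bre v := hasJet_linear (isLinearMap_bdot_re (m := m) v)
  have bim v := hasJet_linear (isLinearMap_bdot_im (m := m) v)
  have om v := hasJet_linear (isLinearMap_Om_zero (m := m) v)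
  have k := HasJet.const (V := Coord m)
  have th v := (k v.2.1).add ((om v).add ((e.const_mul (2 * c)).mul (im v)))
  have h := ((((e.const_mul ((ρ + c) / ρ)).mul ((k (hdot v.1 w.1).re).add
    (e.mul (((re v).mul (re w)).add ((im v).mul (im w)))))).add
    (((th v).mul (th w)).const_mul (1 / (4 * ρ ^ 2) * ((ρ + c) / (ρ + 2 * c))))).add
    (k (-(2 / ρ * ((conj (v.2.2 0) * w.2.2 0).re - (hdot (wTail v) (wTail w)).re))))).add
    ((e.const_mul ((ρ + c) / ρ ^ 2 * 4)).mul
      ((((k (v.2.2 0).re).add (bre (wTail v))).mul ((k (w.2.2 0).re).add (bre (wTail w)))).add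
        (((k (v.2.2 0).im).add (bim (wTail v))).mul ((k (w.2.2 0).im).add (bim (wTail w))))))
  have h' := h.congr (Filter.Eventually.of_forall fun p => show _ = gmet m ρ c p v w by
    rw [gmet_apply, Complex.add_re, Complex.add_re, Complex.add_im, Complex.add_im]; ring)
  refine ⟨h'.contDiffAt, h'.value.trans ?_, fun u => (h'.first u).trans ?_,
    fun t u => (h'.second t u).trans ?_⟩
  · simp only [coeffX, coeffPhi, coeffW, coeffU, Complex.mul_re, Complex.conj_re, Complex.conj_im]
    ring
  · simp only [Om, coeffPhi, coeffU, Complex.add_re, Complex.mul_re, Complex.conj_re, Complex.conj_im,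
      Complex.mul_im]
    ring
  · simp only [Om, coeffX, coeffPhi, coeffU, Complex.add_re, Complex.mul_re, Complex.conj_re, Complex.conj_im,
      Complex.mul_im]
    ring

theorem contDiffAt_of_clm_apply {V E F : Type*} [NormedAddCommGroup V] [NormedSpace ℝ V]
    [NormedAddCommGroup E] [NormedSpace ℝ E] [FiniteDimensional ℝ E] [NormedAddCommGroup F]
    [NormedSpace ℝ F] {f : V → E →L[ℝ] F} {x : V} {n : WithTop ℕ∞}
    (h : ∀ y, ContDiffAt ℝ n (fun x => f x y) x) : ContDiffAt ℝ n f x := by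
  let d := Module.finrank ℝ E
  have hd : d = Module.finrank ℝ (Fin d → ℝ) := (Module.finrank_fin_fun ℝ).symm
  let e₁ := ContinuousLinearEquiv.ofFinrankEq hd
  let e₂ := (e₁.arrowCongr (1 : F ≃L[ℝ] F)).trans (ContinuousLinearEquiv.piRing (Fin d))
  rw [← Function.id_comp f, ← e₂.symm_comp_self]
  exact e₂.symm.contDiff.contDiffAt.comp x (contDiffAt_pi.mpr fun i => h _)

theorem contDiffAt_gmet (ρ c : ℝ) : ContDiffAt ℝ 2 (gmet m ρ c) 0 :=
  contDiffAt_of_clm_apply fun v => contDiffAt_of_clm_apply fun w => (hasJet_gmet ρ c v w).contDiffAt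

theorem gmet_zero (ρ c : ℝ) (v w : Coord m) : gmet m ρ c 0 v w =
    coeffX ρ c * (hdot v.1 w.1).re + coeffPhi ρ c * (v.2.1 * w.2.1)
      + (coeffU ρ c - coeffW ρ) * (conj (v.2.2 0) * w.2.2 0).re
      + coeffW ρ * (hdot (wTail v) (wTail w)).re :=
  ((hasJet_gmet ρ c v w).of_clm_apply (contDiffAt_gmet ρ c)).1

theorem fderiv_gmet_zero (ρ c : ℝ) (u v w : Coord m) : fderiv ℝ (gmet m ρ c) 0 u v w =
    coeffPhi ρ c * (v.2.1 * Om c u w + w.2.1 * Om c u v)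
      + coeffU ρ c * (conj (v.2.2 0) * bdot u.1 (wTail w)
        + conj (w.2.2 0) * bdot u.1 (wTail v)).re :=
  ((hasJet_gmet ρ c v w).of_clm_apply (contDiffAt_gmet ρ c)).2.1 u

theorem fderiv_fderiv_gmet_zero (ρ c : ℝ) (t u v w : Coord m) :
    fderiv ℝ (fderiv ℝ (gmet m ρ c)) 0 t u v w =
      coeffX ρ c * (2 * (hdot t.1 u.1).re * (hdot v.1 w.1).re
          + (conj (hdot t.1 v.1) * hdot u.1 w.1 + conj (hdot u.1 v.1) * hdot t.1 w.1).re)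
      + coeffPhi ρ c * (Om c t v * Om c u w + Om c u v * Om c t w)
      + coeffU ρ c * (2 * (hdot t.1 u.1).re * (conj (v.2.2 0) * w.2.2 0).re
          + (conj (bdot t.1 (wTail v)) * bdot u.1 (wTail w)
            + conj (bdot u.1 (wTail v)) * bdot t.1 (wTail w)).re) :=
  ((hasJet_gmet ρ c v w).of_clm_apply (contDiffAt_gmet ρ c)).2.2 t u

end MetricJet

/-! ### The Christoffel symbols at the origin -/

section Christoffel

variable {m : ℕ} {ρ c : ℝ}

theorem coeffX_pos (hρ : 0 < ρ) (hc : 0 ≤ c) : 0 < coeffX ρ c := by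
  unfold coeffX; positivity

theorem coeffPhi_pos (hρ : 0 < ρ) (hc : 0 ≤ c) : 0 < coeffPhi ρ c := by
  unfold coeffPhi; positivity

theorem coeffW_pos (hρ : 0 < ρ) : 0 < coeffW ρ := by
  unfold coeffW; positivity

theorem coeffU_sub_coeffW (hρ : 0 < ρ) :
    coeffU ρ c - coeffW ρ = 2 * (ρ + 2 * c) / ρ ^ 2 := by
  unfold coeffU coeffW; field_simp; ring

theorem coeffU_sub_coeffW_pos (hρ : 0 < ρ) (hc : 0 ≤ c) : 0 < coeffU ρ c - coeffW ρ := by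
  rw [coeffU_sub_coeffW hρ]; positivity

theorem hdot_self_re (X : Fin m → ℂ) : (hdot X X).re = ∑ a, Complex.normSq (X a) := by
  simp [hdot, Complex.normSq_apply]

theorem hdot_self_im (X : Fin m → ℂ) : (hdot X X).im = 0 := by
  simp [hdot, mul_comm]

theorem hdot_self_re_nonneg (X : Fin m → ℂ) : 0 ≤ (hdot X X).re := by
  rw [hdot_self_re]; exact Finset.sum_nonneg fun a _ => Complex.normSq_nonneg _

theorem eq_zero_of_hdot_self_re {X : Fin m → ℂ} (h : (hdot X X).re = 0) : X = 0 := by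
  rw [hdot_self_re, Finset.sum_eq_zero_iff_of_nonneg fun a _ => Complex.normSq_nonneg _] at h
  ext1 a
  exact Complex.normSq_eq_zero.1 (h a (Finset.mem_univ a))

theorem isInvertible_of_definite {V : Type*} [NormedAddCommGroup V] [NormedSpace ℝ V]
    [FiniteDimensional ℝ V] (B : V →L[ℝ] V →L[ℝ] ℝ) (h : ∀ v, B v v = 0 → v = 0) :
    B.IsInvertible := by
  have hinj : Function.Injective (B : V →ₗ[ℝ] V →L[ℝ] ℝ) := by
    rw [← LinearMap.ker_eq_bot, LinearMap.ker_eq_bot']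
    intro v hv
    refine h v ?_
    have := DFunLike.congr_fun hv v
    simpa using this
  have hfin : Module.finrank ℝ V = Module.finrank ℝ (V →L[ℝ] ℝ) := by
    rw [← LinearEquiv.finrank_eq (LinearMap.toContinuousLinearMap : (V →ₗ[ℝ] ℝ) ≃ₗ[ℝ] _)]
    exact (Subspace.dual_finrank_eq (K := ℝ) (V := V)).symm
  refine ⟨(LinearEquiv.ofInjectiveOfFinrankEq _ hinj hfin).toContinuousLinearEquiv, ?_⟩
  ext v w
  rfl

theorem eq_zero_of_gmet_zero_self (hρ : 0 < ρ) (hc : 0 ≤ c) {v : Coord m}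
    (hv : gmet m ρ c 0 v v = 0) : v = 0 := by
  have h1 := coeffX_pos hρ hc
  have h2 := coeffPhi_pos hρ hc
  have h3 := coeffW_pos hρ
  have h4 := coeffU_sub_coeffW_pos hρ hc
  have e : (conj (v.2.2 0) * v.2.2 0).re = Complex.normSq (v.2.2 0) := by
    simp [Complex.normSq_apply]
  rw [gmet_zero, e] at hv
  have p1 := mul_nonneg h1.le (hdot_self_re_nonneg v.1)
  have p2 := mul_nonneg h2.le (mul_self_nonneg v.2.1)
  have p3 := mul_nonneg h3.le (hdot_self_re_nonneg (wTail v))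
  have p4 := mul_nonneg h4.le (Complex.normSq_nonneg (v.2.2 0))
  have z1 : v.1 = 0 := eq_zero_of_hdot_self_re
    ((mul_eq_zero.1 (le_antisymm (by linarith) p1)).resolve_left h1.ne')
  have z2 : v.2.1 = 0 := mul_self_eq_zero.1
    ((mul_eq_zero.1 (le_antisymm (by linarith) p2)).resolve_left h2.ne')
  have z3 : wTail v = 0 := eq_zero_of_hdot_self_re
    ((mul_eq_zero.1 (le_antisymm (by linarith) p3)).resolve_left h3.ne')
  have z4 : v.2.2 0 = 0 := Complex.normSq_eq_zero.1
    ((mul_eq_zero.1 (le_antisymm (by linarith) p4)).resolve_left h4.ne')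
  refine Prod.ext z1 (Prod.ext z2 (funext fun k => ?_))
  refine Fin.cases z4 (fun a => ?_) k
  exact congrFun z3 a

theorem gmet_zero_isInvertible (hρ : 0 < ρ) (hc : 0 ≤ c) : (gmet m ρ c 0).IsInvertible :=
  isInvertible_of_definite _ fun _ => eq_zero_of_gmet_zero_self hρ hc

/-- The Christoffel symbols `Γ(u, v)` of the metric at the origin, in coordinates. -/
def gamma (ρ c : ℝ) (u v : Coord m) : Coord m :=
  ((((2 * c * coeffPhi ρ c / coeffX ρ c * v.2.1 : ℝ) : ℂ) * Complex.I) • u.1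
      + (((2 * c * coeffPhi ρ c / coeffX ρ c * u.2.1 : ℝ) : ℂ) * Complex.I) • v.1
      + (((-(coeffU ρ c / (2 * coeffX ρ c)) : ℝ) : ℂ) * u.2.2 0) • star (wTail v)
      + (((-(coeffU ρ c / (2 * coeffX ρ c)) : ℝ) : ℂ) * v.2.2 0) • star (wTail u),
    0,
    Fin.cons (((-(4 * coeffPhi ρ c / (coeffU ρ c - coeffW ρ)) : ℝ) : ℂ) * Complex.I *
          (v.2.1 * u.2.2 0 + u.2.1 * v.2.2 0)
        + ((coeffU ρ c / (2 * (coeffU ρ c - coeffW ρ)) : ℝ) : ℂ) *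
          (bdot u.1 (wTail v) + bdot v.1 (wTail u)))
      ((((4 * coeffPhi ρ c / coeffW ρ * v.2.1 : ℝ) : ℂ) * Complex.I) • wTail u
        + (((4 * coeffPhi ρ c / coeffW ρ * u.2.1 : ℝ) : ℂ) * Complex.I) • wTail v
        + (((coeffU ρ c / (2 * coeffW ρ) : ℝ) : ℂ) * v.2.2 0) • star u.1
        + (((coeffU ρ c / (2 * coeffW ρ) : ℝ) : ℂ) * u.2.2 0) • star v.1))

/-- `gamma` solves the linear equations `g (Γ (u, v), t) = Γ (u, v; t)` which define the Christoffel
symbols. -/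
theorem christoffel_gmet_zero (hρ : 0 < ρ) (hc : 0 ≤ c) (u v : Coord m) :
    christoffel (gmet m ρ c) 0 u v = gamma ρ c u v := by
  refine christoffel_eq (gmet_zero_isInvertible hρ hc) fun t => ?_
  rw [christoffelFirst_apply]
  simp only [fderiv_gmet_zero, gmet_zero]
  have h1 := (coeffX_pos hρ hc).ne'
  have h3 := (coeffW_pos hρ).ne'
  have h4 := (coeffU_sub_coeffW_pos hρ hc).ne'
  have htail : ∀ (X : Fin m → ℂ) (s : ℝ) (z : ℂ) (W : Fin m → ℂ),
      wTail ((X, s, Fin.cons z W) : Coord m) = W := fun X s z W => rfl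
  simp only [gamma, htail, hdot_add_left, hdot_smul_left, hdot_star_left, Om, Fin.cons_zero]
  rw [hdot_conj (wTail v) (wTail u), hdot_conj v.1 u.1, hdot_conj (wTail u) (wTail t),
    hdot_conj u.1 t.1, hdot_conj (wTail v) (wTail t), hdot_conj v.1 t.1,
    bdot_comm t.1 (wTail v), bdot_comm t.1 (wTail u)]
  -- only the nonvanishing of the coefficients of the metric matters from here on
  generalize coeffX ρ c = lam at *
  generalize coeffW ρ = nu at *
  generalize coeffU ρ c = kap at *
  generalize coeffPhi ρ c = beta at *
  simp only [map_add, map_mul, Complex.conj_ofReal, Complex.conj_I, Complex.add_re, Complex.add_im,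
    Complex.mul_re, Complex.mul_im, Complex.ofReal_re, Complex.ofReal_im, Complex.I_re,
    Complex.I_im, Complex.neg_re, Complex.neg_im, Complex.conj_re, Complex.conj_im]
  field_simp
  ring

end Christoffel

/-! ### The Ricci tensor at the origin -/

section RicciCurvature

variable {m : ℕ} {ρ c : ℝ}

/-- The vector with `X^a = z` and all other coordinates zero. -/
def vecX (a : Fin m) (z : ℂ) : Coord m := (Pi.single a z, 0, 0)

/-- The coordinate vector `∂_φ̃`. -/
def vecPhi (m : ℕ) : Coord m := (0, 1, 0)

/-- The vector with `w^k = z` and all other coordinates zero. -/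
def vecW (k : Fin (m + 1)) (z : ℂ) : Coord m := (0, 0, Pi.single k z)

/-- The coordinate basis: the real and imaginary directions of the `X^a`, then `∂_φ̃`, then the
real and imaginary directions of the `w^k`. -/
def coordBasis (m : ℕ) :
    Module.Basis ((_ : Fin m) × Fin 2 ⊕ Unit ⊕ (_ : Fin (m + 1)) × Fin 2) ℝ (Coord m) :=
  (Pi.basis fun _ => Complex.basisOneI).prod
    ((Module.Basis.singleton Unit ℝ).prod (Pi.basis fun _ => Complex.basisOneI))

theorem coordBasis_X (a : Fin m) (j : Fin 2) :
    coordBasis m (.inl ⟨a, j⟩) = vecX a (![1, Complex.I] j) := by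
  fin_cases j <;> simp [coordBasis, vecX, Pi.basis_apply] <;> rfl

theorem coordBasis_phi (u : Unit) : coordBasis m (.inr (.inl u)) = vecPhi m := by
  simp [coordBasis, vecPhi]

theorem coordBasis_W (k : Fin (m + 1)) (j : Fin 2) :
    coordBasis m (.inr (.inr ⟨k, j⟩)) = vecW k (![1, Complex.I] j) := by
  simp [coordBasis, vecW, Pi.basis_apply]

theorem hdot_single_left (a : Fin m) (z : ℂ) (Y : Fin m → ℂ) :
    hdot (Pi.single a z) Y = conj z * Y a := by
  rw [hdot, Finset.sum_eq_single a] <;> simp +contextual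

theorem hdot_single_right (a : Fin m) (z : ℂ) (X : Fin m → ℂ) :
    hdot X (Pi.single a z) = conj (X a) * z := by
  rw [hdot, Finset.sum_eq_single a] <;> simp +contextual

theorem bdot_single_left (a : Fin m) (z : ℂ) (Y : Fin m → ℂ) :
    bdot (Pi.single a z) Y = z * Y a := by
  rw [bdot, Finset.sum_eq_single a] <;> simp +contextual

theorem bdot_single_right (a : Fin m) (z : ℂ) (X : Fin m → ℂ) :
    bdot X (Pi.single a z) = X a * z := by
  rw [bdot, Finset.sum_eq_single a] <;> simp +contextual

@[simp] theorem hdot_zero_left (Y : Fin m → ℂ) : hdot 0 Y = 0 := by simp [hdot]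
@[simp] theorem hdot_zero_right (Y : Fin m → ℂ) : hdot Y 0 = 0 := by simp [hdot]
@[simp] theorem bdot_zero_left (Y : Fin m → ℂ) : bdot 0 Y = 0 := by simp [bdot]
@[simp] theorem bdot_zero_right (Y : Fin m → ℂ) : bdot Y 0 = 0 := by simp [bdot]

theorem wTail_mk (X : Fin m → ℂ) (s : ℝ) (z : ℂ) (W : Fin m → ℂ) :
    wTail ((X, s, Fin.cons z W) : Coord m) = W := rfl

@[simp] theorem wTail_vecX (a : Fin m) (z : ℂ) : wTail (vecX a z) = 0 := rfl
@[simp] theorem wTail_vecPhi : wTail (vecPhi m) = 0 := rfl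

@[simp] theorem wTail_vecW_zero (z : ℂ) : wTail (vecW (m := m) 0 z) = 0 := by
  ext a; simp [wTail, vecW]

@[simp] theorem wTail_vecW_succ (a : Fin m) (z : ℂ) :
    wTail (vecW a.succ z) = Pi.single a z := by
  ext b; simp [wTail, vecW, Pi.single_apply]

theorem gmet_zero_vecX (a : Fin m) (z : ℂ) (t : Coord m) :
    gmet m ρ c 0 (vecX a z) t = coeffX ρ c * (conj z * t.1 a).re := by
  rw [gmet_zero, wTail_vecX]; simp [vecX, hdot_single_left]

theorem gmet_zero_vecPhi (t : Coord m) :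
    gmet m ρ c 0 (vecPhi m) t = coeffPhi ρ c * t.2.1 := by
  rw [gmet_zero, wTail_vecPhi]; simp [vecPhi]

theorem gmet_zero_vecW_zero (z : ℂ) (t : Coord m) :
    gmet m ρ c 0 (vecW 0 z) t = (coeffU ρ c - coeffW ρ) * (conj z * t.2.2 0).re := by
  rw [gmet_zero, wTail_vecW_zero]; simp [vecW]

theorem gmet_zero_vecW_succ (a : Fin m) (z : ℂ) (t : Coord m) :
    gmet m ρ c 0 (vecW a.succ z) t = coeffW ρ * (conj z * t.2.2 a.succ).re := by
  rw [gmet_zero, wTail_vecW_succ]; simp [vecW, hdot_single_left, wTail]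

theorem coordBasis_orthogonal (i j) (h : i ≠ j) :
    gmet m ρ c 0 (coordBasis m i) (coordBasis m j) = 0 := by
  have hI : ∀ k l : Fin 2, k ≠ l → (conj (![1, Complex.I] k) * ![1, Complex.I] l : ℂ).re = 0 := by
    intro k l hkl
    fin_cases k <;> fin_cases l <;> simp_all
  have hs : ∀ a b : Fin (m + 1), ∀ k l : Fin 2,
      (Sum.inr (Sum.inr ⟨a, k⟩) : (_ : Fin m) × Fin 2 ⊕ Unit ⊕ (_ : Fin (m + 1)) × Fin 2)
        ≠ Sum.inr (Sum.inr ⟨b, l⟩) →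
      (conj (![1, Complex.I] k) * (Pi.single b (![1, Complex.I] l) : Fin (m + 1) → ℂ) a).re = 0 := by
    intro a b k l h
    by_cases hab : a = b
    · subst hab
      have : k ≠ l := by rintro rfl; exact h rfl
      simp [hI k l this]
    · simp [hab]
  rcases i with ⟨a, k⟩ | ⟨⟩ | ⟨a, k⟩
  · rw [coordBasis_X, gmet_zero_vecX]
    rcases j with ⟨b, l⟩ | ⟨⟩ | ⟨b, l⟩
    · by_cases hab : a = b
      · subst hab
        have : k ≠ l := by rintro rfl; exact h rfl
        simp [coordBasis_X, vecX, hI k l this]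
      · simp [coordBasis_X, vecX, hab]
    · simp [coordBasis_phi, vecPhi]
    · simp [coordBasis_W, vecW]
  · rw [coordBasis_phi, gmet_zero_vecPhi]
    rcases j with ⟨b, l⟩ | ⟨⟩ | ⟨b, l⟩
    · simp [coordBasis_X, vecX]
    · exact absurd rfl h
    · simp [coordBasis_W, vecW]
  · rw [coordBasis_W]
    have key : (conj (![1, Complex.I] k) * (coordBasis m j).2.2 a).re = 0 := by
      rcases j with ⟨b, l⟩ | ⟨⟩ | ⟨b, l⟩
      · simp [coordBasis_X, vecX]
      · simp [coordBasis_phi, vecPhi]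
      · rw [coordBasis_W]; exact hs a b k l h
    revert key
    refine Fin.cases (fun key => ?_) (fun a key => ?_) a
    · rw [gmet_zero_vecW_zero, key, mul_zero]
    · rw [gmet_zero_vecW_succ, key, mul_zero]

theorem bdot_smul_left (z : ℂ) (X Y : Fin m → ℂ) : bdot (z • X) Y = z * bdot X Y := by
  simp [bdot, Finset.mul_sum, mul_assoc]

theorem bdot_star_left (X Y : Fin m → ℂ) : bdot (star X) Y = hdot X Y := rfl

theorem hdot_star_right (X Y : Fin m → ℂ) : hdot X (star Y) = conj (bdot X Y) := by
  simp [hdot, bdot]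

/-- The contribution of the direction `u` to `Ric(v, v)`: the summand of `ricci_eq_sum` for a basis
vector `u`, which need not have length one. -/
def ricciTerm (ρ c : ℝ) (v u : Coord m) : ℝ :=
  ((1 / 2) *
      (fderiv ℝ (fderiv ℝ (gmet m ρ c)) 0 u v v u - fderiv ℝ (fderiv ℝ (gmet m ρ c)) 0 u u v v
        - fderiv ℝ (fderiv ℝ (gmet m ρ c)) 0 v v u u + fderiv ℝ (fderiv ℝ (gmet m ρ c)) 0 v u u v)
      + gmet m ρ c 0 (gamma ρ c v u) (gamma ρ c u v)) / gmet m ρ c 0 u u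

/-- The two directions `∂_{Re X^a}` and `∂_{Im X^a}` together: the terms that depend on the argument
of `Y^a` cancel. -/
theorem ricciTerm_vecX (hρ : 0 < ρ) (hc : 0 ≤ c) (v : Coord m) (a : Fin m) :
    ricciTerm ρ c v (vecX a 1) + ricciTerm ρ c v (vecX a Complex.I) =
      (-2 * coeffX ρ c * (hdot v.1 v.1).re - 2 * coeffX ρ c * Complex.normSq (v.1 a)
        - 12 * c ^ 2 * coeffPhi ρ c * Complex.normSq (v.1 a)
        - 2 * coeffU ρ c * (Complex.normSq (wTail v a) + Complex.normSq (v.2.2 0))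
        + 8 * c ^ 2 * coeffPhi ρ c ^ 2 * v.2.1 ^ 2 / coeffX ρ c
        + coeffU ρ c ^ 2 / (2 * (coeffU ρ c - coeffW ρ)) * Complex.normSq (wTail v a)
        + coeffU ρ c ^ 2 / (2 * coeffW ρ) * Complex.normSq (v.2.2 0)) / coeffX ρ c := by
  have h1 := (coeffX_pos hρ hc).ne'
  have h3 := (coeffW_pos hρ).ne'
  have h4 := (coeffU_sub_coeffW_pos hρ hc).ne'
  have hn : ∀ z : ℂ, gmet m ρ c 0 (vecX a z) (vecX a z) = coeffX ρ c * Complex.normSq z := by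
    intro z; rw [gmet_zero_vecX]; simp [vecX, Complex.normSq_apply]
  have hs := hdot_self_im v.1
  simp only [ricciTerm, hn, fderiv_fderiv_gmet_zero, gmet_zero, gamma, Om, wTail_mk, wTail_vecX,
    hdot_zero_left, hdot_zero_right, bdot_zero_right]
  generalize coeffX ρ c = lam at *
  generalize coeffW ρ = nu at *
  generalize coeffU ρ c = kap at *
  generalize coeffPhi ρ c = beta at *
  simp only [vecX, Fin.cons_zero, hdot_add_left, hdot_add_right, hdot_smul_left, hdot_smul_right,
    hdot_star_left, hdot_single_left, hdot_single_right, bdot_single_left, bdot_single_right,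
    Pi.zero_apply, Pi.single_eq_same, hdot_star_right, star_zero, smul_zero, Pi.add_apply,
    Pi.smul_apply, Pi.star_apply, smul_eq_mul, Complex.star_def, hdot_zero_left, hdot_zero_right]
  simp only [map_mul, map_zero, map_one, Complex.conj_ofReal, Complex.conj_I, Complex.add_re,
    Complex.mul_re, Complex.mul_im, Complex.ofReal_re, Complex.ofReal_im, Complex.I_re,
    Complex.I_im, Complex.one_re, Complex.one_im, Complex.zero_re, Complex.zero_im, Complex.neg_re,
    Complex.neg_im, Complex.conj_re, Complex.conj_im, hs, Complex.normSq_apply, Complex.ofReal_zero,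
    mul_zero, zero_mul, add_zero, zero_add, sub_zero, zero_sub, neg_zero, mul_one, one_mul]
  field_simp
  ring

theorem ricciTerm_vecPhi (hρ : 0 < ρ) (hc : 0 ≤ c) (v : Coord m) :
    ricciTerm ρ c v (vecPhi m) =
      4 * c ^ 2 * coeffPhi ρ c / coeffX ρ c * (hdot v.1 v.1).re
        + 16 * coeffPhi ρ c / (coeffU ρ c - coeffW ρ) * Complex.normSq (v.2.2 0)
        + 16 * coeffPhi ρ c / coeffW ρ * (hdot (wTail v) (wTail v)).re := by
  have h1 := (coeffX_pos hρ hc).ne'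
  have h2 := (coeffPhi_pos hρ hc).ne'
  have h3 := (coeffW_pos hρ).ne'
  have h4 := (coeffU_sub_coeffW_pos hρ hc).ne'
  have hn : gmet m ρ c 0 (vecPhi m) (vecPhi m) = coeffPhi ρ c := by
    rw [gmet_zero_vecPhi]; simp [vecPhi]
  have hs := hdot_self_im v.1
  have hs' := hdot_self_im (wTail v)
  simp only [ricciTerm, hn, fderiv_fderiv_gmet_zero, gmet_zero, gamma, Om, wTail_mk, wTail_vecPhi,
    hdot_zero_left, hdot_zero_right, bdot_zero_right]
  generalize coeffX ρ c = lam at *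
  generalize coeffW ρ = nu at *
  generalize coeffU ρ c = kap at *
  generalize coeffPhi ρ c = beta at *
  simp only [vecPhi, Fin.cons_zero, hdot_smul_left, hdot_smul_right, Pi.zero_apply, star_zero,
    smul_zero, zero_smul, mul_zero, add_zero, zero_add, hdot_zero_left, hdot_zero_right,
    bdot_zero_left]
  simp only [map_mul, map_zero, Complex.conj_ofReal, Complex.conj_I, Complex.mul_re, Complex.mul_im,
    Complex.ofReal_re, Complex.ofReal_im, Complex.I_re, Complex.I_im, Complex.zero_re,
    Complex.zero_im, Complex.neg_re, Complex.neg_im, Complex.conj_re, Complex.conj_im, hs, hs',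
    Complex.normSq_apply, mul_zero, zero_mul, add_zero, zero_add, sub_zero, zero_sub, neg_zero,
    mul_one, one_mul]
  field_simp
  ring

theorem ricciTerm_vecW_zero (hρ : 0 < ρ) (hc : 0 ≤ c) (v : Coord m) :
    ricciTerm ρ c v (vecW 0 1) + ricciTerm ρ c v (vecW 0 Complex.I) =
      (-48 * coeffPhi ρ c * Complex.normSq (v.2.2 0) - 2 * coeffU ρ c * (hdot v.1 v.1).re
        + 32 * coeffPhi ρ c ^ 2 / (coeffU ρ c - coeffW ρ) * v.2.1 ^ 2
        + coeffU ρ c ^ 2 / (2 * coeffW ρ) * (hdot v.1 v.1).re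
        + coeffU ρ c ^ 2 / (2 * coeffX ρ c) * (hdot (wTail v) (wTail v)).re)
      / (coeffU ρ c - coeffW ρ) := by
  have h1 := (coeffX_pos hρ hc).ne'
  have h2 := (coeffPhi_pos hρ hc).ne'
  have h3 := (coeffW_pos hρ).ne'
  have h4 := (coeffU_sub_coeffW_pos hρ hc).ne'
  have hn : ∀ z : ℂ, gmet m ρ c 0 (vecW 0 z) (vecW 0 z) =
      (coeffU ρ c - coeffW ρ) * Complex.normSq z := by
    intro z; rw [gmet_zero_vecW_zero]; simp [vecW, Complex.normSq_apply]
  have hs := hdot_self_im v.1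
  have hs' := hdot_self_im (wTail v)
  simp only [ricciTerm, hn, fderiv_fderiv_gmet_zero, gmet_zero, gamma, Om, wTail_mk,
    wTail_vecW_zero, hdot_zero_left, hdot_zero_right, bdot_zero_right]
  generalize coeffX ρ c = lam at *
  generalize coeffW ρ = nu at *
  generalize coeffU ρ c = kap at *
  generalize coeffPhi ρ c = beta at *
  simp only [vecW, Fin.cons_zero, hdot_smul_right, Pi.single_eq_same, hdot_star_right,
    bdot_smul_left, bdot_star_left, star_zero, smul_zero, zero_smul, Complex.ofReal_zero, mul_zero,
    zero_mul, add_zero, zero_add, hdot_zero_left, hdot_zero_right, bdot_zero_left]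
  simp only [map_mul, map_zero, map_one, Complex.conj_ofReal, Complex.conj_I, Complex.mul_re,
    Complex.mul_im, Complex.ofReal_re, Complex.ofReal_im, Complex.I_re, Complex.I_im,
    Complex.one_re, Complex.one_im, Complex.zero_re, Complex.zero_im, Complex.neg_re,
    Complex.neg_im, Complex.conj_re, Complex.conj_im, hs, hs', Complex.normSq_apply, mul_zero,
    zero_mul, add_zero, zero_add, sub_zero, zero_sub, neg_zero, mul_one, one_mul]
  field_simp
  ring

theorem ricciTerm_vecW_succ (hρ : 0 < ρ) (hc : 0 ≤ c) (v : Coord m) (a : Fin m) :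
    ricciTerm ρ c v (vecW a.succ 1) + ricciTerm ρ c v (vecW a.succ Complex.I) =
      (-48 * coeffPhi ρ c * Complex.normSq (wTail v a) - 2 * coeffU ρ c * Complex.normSq (v.1 a)
        + 32 * coeffPhi ρ c ^ 2 / coeffW ρ * v.2.1 ^ 2
        + coeffU ρ c ^ 2 / (2 * (coeffU ρ c - coeffW ρ)) * Complex.normSq (v.1 a)
        + coeffU ρ c ^ 2 / (2 * coeffX ρ c) * Complex.normSq (v.2.2 0)) / coeffW ρ := by
  have h1 := (coeffX_pos hρ hc).ne'
  have h2 := (coeffPhi_pos hρ hc).ne'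
  have h3 := (coeffW_pos hρ).ne'
  have h4 := (coeffU_sub_coeffW_pos hρ hc).ne'
  have hn : ∀ z : ℂ, gmet m ρ c 0 (vecW a.succ z) (vecW a.succ z) =
      coeffW ρ * Complex.normSq z := by
    intro z; rw [gmet_zero_vecW_succ]; simp [vecW, Complex.normSq_apply]
  have h0 : ∀ z : ℂ, (Pi.single a.succ z : Fin (m + 1) → ℂ) 0 = 0 := fun z => by simp
  have hs := hdot_self_im v.1
  have hs' := hdot_self_im (wTail v)
  simp only [ricciTerm, hn, fderiv_fderiv_gmet_zero, gmet_zero, gamma, Om, wTail_mk,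
    wTail_vecW_succ]
  generalize coeffX ρ c = lam at *
  generalize coeffW ρ = nu at *
  generalize coeffU ρ c = kap at *
  generalize coeffPhi ρ c = beta at *
  simp only [vecW, h0, Fin.cons_zero, hdot_smul_right, hdot_single_left, hdot_single_right,
    bdot_single_right, Pi.zero_apply, Pi.single_eq_same, hdot_star_right, star_zero, smul_zero,
    zero_smul, Complex.ofReal_zero, mul_zero, zero_mul, add_zero, zero_add, Pi.smul_apply,
    Pi.star_apply, smul_eq_mul, Complex.star_def, hdot_zero_left, hdot_zero_right, bdot_zero_left]
  simp only [map_mul, map_zero, map_one, Complex.conj_ofReal, Complex.conj_I, Complex.add_re,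
    Complex.mul_re, Complex.mul_im, Complex.ofReal_re, Complex.ofReal_im, Complex.I_re,
    Complex.I_im, Complex.one_im, Complex.zero_re, Complex.zero_im, Complex.neg_re, Complex.neg_im,
    Complex.conj_re, Complex.conj_im, hs, hs', Complex.normSq_apply, mul_zero, zero_mul, add_zero,
    zero_add, sub_zero, zero_sub, neg_zero, mul_one, one_mul]
  field_simp
  ring

end RicciCurvature

/-! ### The Ricci endomorphism at the origin -/

section RicciEndomorphism

variable {m : ℕ} {ρ c : ℝ}

theorem gamma_coordBasis_self (i) : gamma ρ c (coordBasis m i) (coordBasis m i) = 0 := by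
  have hcons : (Fin.cons 0 0 : Fin (m + 1) → ℂ) = 0 := by
    ext k; refine Fin.cases ?_ (fun b => ?_) k <;> simp
  rcases i with ⟨a, k⟩ | u | ⟨a, k⟩
  · rw [coordBasis_X, gamma, wTail_vecX]
    simp [vecX, hcons]
  · rw [coordBasis_phi, gamma, wTail_vecPhi]
    simp [vecPhi, hcons]
  · rw [coordBasis_W]
    generalize ![1, Complex.I] k = z
    refine Fin.cases ?_ (fun b => ?_) a
    · rw [gamma, wTail_vecW_zero]
      simp [vecW, hcons]
    · rw [gamma, wTail_vecW_succ]
      simp [vecW, hcons]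

theorem gamma_comm (u v : Coord m) : gamma ρ c u v = gamma ρ c v u := by
  simp only [gamma]
  refine Prod.ext ?_ (Prod.ext rfl ?_)
  · simp only; abel
  · simp only
    congr 1
    · ring
    · abel

theorem ricci_gmet_zero_comm (hρ : 0 < ρ) (hc : 0 ≤ c) (v w : Coord m) :
    ricci (gmet m ρ c) 0 v w = ricci (gmet m ρ c) 0 w v := by
  have hx := gmet_zero_isInvertible (m := m) hρ hc
  have hn : ∀ i, gmet m ρ c 0 (coordBasis m i) (coordBasis m i) ≠ 0 := fun i h =>
    (coordBasis m).ne_zero i (eq_zero_of_gmet_zero_self hρ hc h)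
  have hΓ : ∀ i, christoffel (gmet m ρ c) 0 (coordBasis m i) (coordBasis m i) = 0 := fun i => by
    rw [christoffel_gmet_zero hρ hc, gamma_coordBasis_self]
  rw [ricci_eq_sum (coordBasis m) (contDiffAt_gmet ρ c) hx (gmet_symm ρ c) coordBasis_orthogonal hn
    hΓ v w, ricci_eq_sum (coordBasis m) (contDiffAt_gmet ρ c) hx (gmet_symm ρ c)
    coordBasis_orthogonal hn hΓ w v]
  refine Finset.sum_congr rfl fun i _ => ?_
  simp only [christoffel_gmet_zero hρ hc]
  rw [gmet_symm ρ c 0 (gamma ρ c v _), gamma_comm _ w, gamma_comm v]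
  congr 2
  simp only [fderiv_fderiv_gmet_zero]
  generalize coordBasis m i = e
  rw [hdot_conj w.1 v.1, hdot_conj e.1 v.1, hdot_conj e.1 w.1]
  simp only [Complex.add_re, Complex.mul_re, Complex.conj_re, Complex.conj_im]
  ring

/-- The Ricci tensor at the origin has no mixed terms, and its coefficients are the products of the
`r_i` with the coefficients of the metric. -/
theorem ricci_gmet_zero_self (hρ : 0 < ρ) (hc : 0 ≤ c) (v : Coord m) :
    ricci (gmet m ρ c) 0 v v =
      r1 (m + 1) ρ c * coeffX ρ c * (hdot v.1 v.1).re
      + r2 (m + 1) ρ c * coeffPhi ρ c * v.2.1 ^ 2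
      + r3 (m + 1) ρ c * (coeffU ρ c - coeffW ρ) * Complex.normSq (v.2.2 0)
      + r4 ρ c * coeffW ρ * (hdot (wTail v) (wTail v)).re := by
  have hx := gmet_zero_isInvertible (m := m) hρ hc
  have hn : ∀ i, gmet m ρ c 0 (coordBasis m i) (coordBasis m i) ≠ 0 := fun i h =>
    (coordBasis m).ne_zero i (eq_zero_of_gmet_zero_self hρ hc h)
  have hΓ : ∀ i, christoffel (gmet m ρ c) 0 (coordBasis m i) (coordBasis m i) = 0 := fun i => by
    rw [christoffel_gmet_zero hρ hc, gamma_coordBasis_self]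
  rw [ricci_eq_sum (coordBasis m) (contDiffAt_gmet ρ c) hx (gmet_symm ρ c) coordBasis_orthogonal hn
    hΓ v v]
  have hterm : ∀ i, ricciTerm ρ c v (coordBasis m i) = _ := fun i => by
    rw [ricciTerm, ← christoffel_gmet_zero hρ hc, ← christoffel_gmet_zero hρ hc]
  simp only [← hterm, Fintype.sum_sum_type, Fintype.sum_sigma, Fin.sum_univ_two, coordBasis_X,
    coordBasis_phi, coordBasis_W, Finset.univ_unique, Finset.sum_singleton,
    Matrix.cons_val_zero, Matrix.cons_val_one]
  -- separate the direction `w^0` from the directions `w^a`, `a ≥ 1`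
  rw [Fin.sum_univ_succ]
  simp only [ricciTerm_vecX hρ hc, ricciTerm_vecPhi hρ hc, ricciTerm_vecW_zero hρ hc,
    ricciTerm_vecW_succ hρ hc, ← Finset.sum_div, Finset.sum_add_distrib, Finset.sum_sub_distrib,
    Finset.sum_const, ← Finset.mul_sum, ← hdot_self_re, Finset.card_univ, Fintype.card_fin,
    nsmul_eq_mul]
  rw [coeffU_sub_coeffW hρ]
  have h1 : ρ + c ≠ 0 := by positivity
  have h2 : ρ + 2 * c ≠ 0 := by positivity
  have h3 : ρ ≠ 0 := hρ.ne'
  generalize (hdot v.1 v.1).re = S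
  generalize (hdot (wTail v) (wTail v)).re = T
  generalize Complex.normSq (v.2.2 0) = N
  generalize v.2.1 = ψ
  simp only [coeffX, coeffPhi, coeffU, coeffW, r1, r2, r3, r4]
  field_simp
  ring

theorem hdot_add_self_re (X Y : Fin m → ℂ) :
    (hdot (X + Y) (X + Y)).re = (hdot X X).re + (hdot Y Y).re + 2 * (hdot X Y).re := by
  rw [hdot_add_left, hdot_add_right, hdot_add_right, hdot_conj X Y]
  simp; ring

/-- The Ricci endomorphism at the origin is diagonal in the coordinates `X, φ̃, w^0, w^a`. -/
theorem ricciEnd_gmet_zero (hρ : 0 < ρ) (hc : 0 ≤ c) (v : Coord m) :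
    ricciEnd (gmet m ρ c) 0 v =
      (r1 (m + 1) ρ c • v.1, r2 (m + 1) ρ c * v.2.1,
        Fin.cons (r3 (m + 1) ρ c • v.2.2 0) (r4 ρ c • wTail v)) := by
  refine ricciEnd_eq (gmet_zero_isInvertible hρ hc) fun t => ?_
  -- polarization of the quadratic form `Ric(v, v)`
  have key : 2 * ricci (gmet m ρ c) 0 v t = ricci (gmet m ρ c) 0 (v + t) (v + t)
      - ricci (gmet m ρ c) 0 v v - ricci (gmet m ρ c) 0 t t := by
    rw [map_add (ricci _ _), LinearMap.add_apply, map_add, map_add, ricci_gmet_zero_comm hρ hc t v]; ring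
  have ht : wTail (v + t) = wTail v + wTail t := rfl
  have hs : ∀ (r : ℝ) (X Y : Fin m → ℂ), (hdot (r • X) Y).re = r * (hdot X Y).re := by
    intro r X Y
    have : r • X = (r : ℂ) • X := by ext; simp
    rw [this, hdot_smul_left]; simp
  rw [ricci_gmet_zero_self hρ hc, ricci_gmet_zero_self hρ hc, ricci_gmet_zero_self hρ hc, ht,
    Prod.fst_add, hdot_add_self_re, hdot_add_self_re] at key
  rw [gmet_zero, wTail_mk, hs, hs]
  simp only [Fin.cons_zero, Prod.snd_add, Prod.fst_add, Pi.add_apply, Complex.normSq_apply,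
    Complex.add_re, Complex.add_im] at key ⊢
  simp only [Complex.mul_re, Complex.conj_re, Complex.conj_im, Complex.real_smul, Complex.mul_im,
    Complex.ofReal_re, Complex.ofReal_im, map_mul, Complex.conj_ofReal]
  linear_combination (-1 / 2) * key

end RicciEndomorphism

/-! ### The Iwasawa subalgebra -/

section Iwasawa

variable {m : ℕ}

theorem u1_apply_swap (A : u1 m) (i j : Fin (m + 1)) :
    A.1 j i = -((if i = 0 then -1 else 1) * (if j = 0 then -1 else 1) * conj (A.1 i j)) := by
  have := congrArg conj (u1_apply A i j)
  rw [Complex.conj_conj] at this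
  rw [this]
  split_ifs <;> simp

theorem sigma_apply (A : Matrix (Fin (m + 1)) (Fin (m + 1)) ℂ) (i j : Fin (m + 1)) :
    sigma A i j = -((if i = 0 then -1 else 1) * conj (A j i) * (if j = 0 then -1 else 1)) := by
  simp [sigma, signMat, Matrix.mul_diagonal, Matrix.diagonal_mul]

theorem sigma_Umat (a : Fin m) : sigma (Umat a) = Matrix.single a.succ 0 1 := by
  ext i j
  rw [sigma_apply, Umat, Matrix.single_apply, Matrix.single_apply]
  by_cases h : a.succ = i ∧ 0 = j
  · obtain ⟨rfl, rfl⟩ := h; simp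
  · have h' : ¬(0 = j ∧ a.succ = i) := fun h' => h h'.symm
    rw [if_neg h, if_neg h']; simp

theorem Bmat_eq (a : Fin m) :
    Bmat a = (if a.val = 0 then 2 else 1 : ℂ) • Matrix.single 0 a.succ 1
      - ((if a.val = 0 then Matrix.single 0 0 1 else 0)
        - Matrix.single (Fin.succ ⟨0, a.pos⟩) a.succ 1) := by
  rw [Bmat, sigma_Umat, Umat, Ring.lie_def, Matrix.single_mul_single_same, mul_one]
  congr 2
  by_cases h : a.val = 0
  · have ha : (⟨0, a.pos⟩ : Fin m) = a := Fin.ext h.symm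
    simp [ha, h]
  · rw [if_neg h, Matrix.single_mul_single_of_ne]
    intro h'
    apply h
    rw [Fin.succ_inj.1 h']

/-- The real Lie algebra of all `A ∈ 𝔲(1, k+1)` with `A_ab = 0` and `A_1a = A_0a` for `a, b ≥ 2`,
`Im A_00 = Im A_10` and `A_11 = -A_00`. -/
def iwasawaModel (k : ℕ) : LieSubalgebra ℝ (u1 (k + 1)) where
  carrier := {A | (∀ i j : Fin k, A.1 i.succ.succ j.succ.succ = 0) ∧
    (∀ j : Fin k, A.1 1 j.succ.succ = A.1 0 j.succ.succ) ∧
    (A.1 0 0).im = (A.1 1 0).im ∧ A.1 1 1 = -A.1 0 0}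
  add_mem' {A B} hA hB := by
    obtain ⟨a1, a2, a3, a4⟩ := hA
    obtain ⟨b1, b2, b3, b4⟩ := hB
    refine ⟨fun i j => ?_, fun j => ?_, ?_, ?_⟩ <;> simp [*]
    ring
  zero_mem' := by
    refine ⟨fun i j => ?_, fun j => ?_, ?_, ?_⟩ <;> simp
  smul_mem' t A hA := by
    obtain ⟨a1, a2, a3, a4⟩ := hA
    refine ⟨fun i j => ?_, fun j => ?_, ?_, ?_⟩ <;> simp [*]
  lie_mem' {A B} hA hB := by
    obtain ⟨a1, a2, a3, a4⟩ := hA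
    obtain ⟨b1, b2, b3, b4⟩ := hB
    have h : ∀ i j, (⁅A, B⁆ : u1 (k + 1)).1 i j =
        (A.1 i 0 * B.1 0 j + (A.1 i 1 * B.1 1 j + ∑ l : Fin k, A.1 i l.succ.succ * B.1 l.succ.succ j))
        - (B.1 i 0 * A.1 0 j
          + (B.1 i 1 * A.1 1 j + ∑ l : Fin k, B.1 i l.succ.succ * A.1 l.succ.succ j)) := by
      intro i j
      change (A.1 * B.1 - B.1 * A.1) i j = _
      simp only [Matrix.sub_apply, Matrix.mul_apply, Fin.sum_univ_succ (n := k + 1),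
        Fin.sum_univ_succ (n := k)]
      rfl
    -- `A_a1 = -A_a0` for `a ≥ 2`, because `A^σ = A`
    have col : ∀ C : u1 (k + 1), (∀ j : Fin k, C.1 1 j.succ.succ = C.1 0 j.succ.succ) →
        ∀ j : Fin k, C.1 j.succ.succ 1 = -C.1 j.succ.succ 0 := by
      intro C hC j
      rw [u1_apply_swap C 1, u1_apply_swap C 0, hC]
      simp
    have h01 : ∀ C : u1 (k + 1), C.1 0 1 = conj (C.1 1 0) := by
      intro C
      rw [u1_apply_swap C 1 0]; simp
    have h00 : ∀ C : u1 (k + 1), (C.1 0 0).re = 0 := by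
      intro C
      have := congrArg Complex.re (u1_apply_swap C 0 0)
      simp at this
      linarith
    have ca := col A a2
    have cb := col B b2
    refine ⟨fun i j => ?_, fun j => ?_, ?_, ?_⟩
    · simp only [h, a1, b1, ca, cb, a2, b2]
      simp
    · simp only [h, a1, b1, a2, b2, a4, b4, h01]
      apply Complex.ext <;> simp [h00, a3, b3]
    · simp only [h, a2, b2, a4, b4, h01]
      simp [h00, a3, b3]
      ring
    · simp only [h, a2, b2, a4, b4, h01, ca, cb]
      simp only [mul_neg, Finset.sum_neg_distrib]
      ring

/-- As the explicit conditions are preserved by brackets, it is enough to check the generators. -/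
theorem iwasawa_le_model (k : ℕ) : iwasawa (k + 1) ≤ iwasawaModel k := by
  refine LieSubalgebra.lieSpan_le.2 ?_
  have h0 : ∀ i : Fin k, ((0 : Fin (k + 2)) = i.succ.succ) = False := fun i =>
    eq_false (Fin.succ_ne_zero _).symm
  have h1 : ∀ i : Fin k, ((1 : Fin (k + 2)) = i.succ.succ) = False := fun i =>
    eq_false fun h => (Fin.succ_ne_zero i).symm (Fin.succ_injective _ h)
  have h2 : ∀ i : Fin k, (i.succ.succ = (1 : Fin (k + 2))) = False := fun i =>
    eq_false fun h => (h1 i).mp h.symm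
  rintro _ (⟨a, rfl⟩ | ⟨a, rfl⟩) <;> refine Fin.cases ?_ (fun a => ?_) a <;>
    refine ⟨fun i j => ?_, fun j => ?_, ?_, ?_⟩ <;>
    simp [rePart, imPart, sigma_apply, Bmat_eq, Matrix.single_apply, h0, h1, h2]
  norm_num

/-- An element of `𝔟` is determined by its first column, hence `dim 𝔟 ≤ 2 (n - 1)`. -/
theorem eq_zero_of_mem_iwasawa {A : u1 m} (hA : A ∈ iwasawa m) (h : ∀ a : Fin m, A.1 a.succ 0 = 0) :
    A = 0 := by
  cases m with
  | zero =>
    have : iwasawa 0 = ⊥ := by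
      rw [iwasawa, Set.range_eq_empty, Set.range_eq_empty, Set.union_empty,
        LieSubalgebra.span_empty]
    rw [this] at hA
    simpa using hA
  | succ k =>
    obtain ⟨a1, a2, a3, a4⟩ := iwasawa_le_model k hA
    have h10 : A.1 1 0 = 0 := h 0
    have h00 : A.1 0 0 = 0 := by
      have := congrArg Complex.re (u1_apply_swap A 0 0)
      simp at this
      apply Complex.ext
      · simp; linarith
      · rw [a3, h10]
    have h0 : ∀ a : Fin (k + 1), A.1 0 a.succ = 0 := fun a => by
      rw [u1_apply_swap A a.succ 0, h]; simp
    have hs : ∀ j : Fin k, A.1 j.succ.succ 1 = 0 := fun j => by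
      rw [u1_apply_swap A 1 j.succ.succ, a2, h0]; simp
    ext i j
    change A.1 i j = 0
    refine Fin.cases ?_ (fun i => ?_) i
    · exact Fin.cases h00 h0 j
    · refine Fin.cases (h i) (fun j => ?_) j
      refine Fin.cases ?_ (fun i => ?_) i
      · refine Fin.cases ?_ (fun j => ?_) j
        · exact a4.trans (by rw [h00, neg_zero])
        · exact (a2 j).trans (h0 _)
      · exact Fin.cases (hs i) (fun j => a1 i j) j

theorem Bmat_col_zero (a b : Fin m) : Bmat a b.succ 0 = 0 := by
  have h0 : (0 : Fin (m + 1)) ≠ b.succ := (Fin.succ_ne_zero b).symm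
  by_cases h : a.val = 0 <;> simp [Bmat_eq, h, h0]

theorem Bmat_row_zero (a b : Fin m) :
    Bmat a 0 b.succ = if b = a then (if a.val = 0 then 2 else 1 : ℂ) else 0 := by
  by_cases h : a.val = 0 <;> simp [Bmat_eq, Matrix.single_apply, h, eq_comm]

theorem Bmat_zero_zero (a : Fin m) : Bmat a 0 0 = if a.val = 0 then -1 else 0 := by
  by_cases h : a.val = 0 <;> simp [Bmat_eq, h]

/-- The entries `1` and `1/2` in the first column of `B_1^R` and of `B_a^R`, `a ≥ 2`. -/
def colCoeff (a : Fin m) : ℝ := if a.val = 0 then 1 else 1 / 2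

theorem colCoeff_ne_zero (a : Fin m) : colCoeff a ≠ 0 := by
  unfold colCoeff; split_ifs <;> norm_num

theorem BR_apply (a b : Fin m) :
    (BR a).1.1 b.succ 0 = if b = a then (colCoeff a : ℂ) else 0 := by
  simp only [BR, rePart, Matrix.smul_apply, Matrix.add_apply, sigma_apply, Bmat_col_zero,
    Bmat_row_zero, colCoeff]
  by_cases h : b = a <;> by_cases h' : a.val = 0 <;> simp [h, h', Complex.conj_ofNat]

theorem BI_apply (a b : Fin m) :
    (BI a).1.1 b.succ 0 = if b = a then (colCoeff a : ℂ) * Complex.I else 0 := by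
  simp only [BI, imPart, Matrix.smul_apply, Matrix.add_apply, sigma_apply, Bmat_col_zero,
    Bmat_row_zero, colCoeff]
  by_cases h : b = a <;> by_cases h' : a.val = 0 <;> simp [h, h', Complex.conj_ofNat]
  ring

theorem BR_zero_zero (a : Fin m) : (BR a).1.1 0 0 = 0 := by
  simp only [BR, rePart, Matrix.smul_apply, Matrix.add_apply, sigma_apply, Bmat_zero_zero]
  by_cases h' : a.val = 0 <;> simp [h']

theorem BI_zero_zero (a : Fin m) : (BI a).1.1 0 0 = if a.val = 0 then Complex.I else 0 := by
  simp only [BI, imPart, Matrix.smul_apply, Matrix.add_apply, sigma_apply, Bmat_zero_zero]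
  by_cases h' : a.val = 0 <;> simp [h']
  ring

/-- The element of `𝔟` with first column `X`, as a combination of the `B_a^R` and `B_a^I`. -/
def iwasawaOfCol (X : Fin m → ℂ) : iwasawa m :=
  ∑ a, (((colCoeff a)⁻¹ * (X a).re) • BR a + ((colCoeff a)⁻¹ * (X a).im) • BI a)

theorem iwasawaOfCol_apply (X : Fin m → ℂ) (b : Fin m) : (iwasawaOfCol X).1.1 b.succ 0 = X b := by
  let f : iwasawa m →ₗ[ℝ] ℂ :=
    { toFun A := A.1.1 b.succ 0, map_add' _ _ := rfl, map_smul' _ _ := rfl }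
  change f (iwasawaOfCol X) = X b
  rw [iwasawaOfCol, map_sum, Finset.sum_eq_single b]
  · have h1 : f (BR b) = colCoeff b := (BR_apply b b).trans (if_pos rfl)
    have h2 : f (BI b) = colCoeff b * Complex.I := (BI_apply b b).trans (if_pos rfl)
    rw [map_add, map_smul, map_smul, h1, h2]
    have := colCoeff_ne_zero b
    apply Complex.ext
    · simp; field_simp
    · simp; field_simp
  · intro a _ hab
    have h1 : f (BR a) = 0 := (BR_apply a b).trans (if_neg hab.symm)
    have h2 : f (BI a) = 0 := (BI_apply a b).trans (if_neg hab.symm)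
    rw [map_add, map_smul, map_smul, h1, h2]; simp
  · simp

end Iwasawa

/-! ### The isomorphism `α_ρ` and the matrices with respect to `𝓑_n` -/

section Isomorphism

variable {m : ℕ} (ρ c : ℝ)

/-- The value of the infinitesimal action at the origin, as a linear map. -/
def actionAtZero (m : ℕ) (c : ℝ) : LieL m →ₗ[ℝ] Coord m where
  toFun x := infAction c x 0
  map_add' x y := by
    have hA : (x + y).right.1.1 = x.right.1.1 + y.right.1.1 := rfl
    have hv : (x + y).left.vec = x.left.vec + y.left.vec := rfl
    have hs : (x + y).left.cen = x.left.cen + y.left.cen := rfl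
    simp only [infAction, multiplier, hA, hv, hs]
    refine Prod.ext ?_ (Prod.ext ?_ ?_)
    · ext a; simp
    · simp; ring
    · simp
  map_smul' t x := by
    have hA : (t • x).right.1.1 = t • x.right.1.1 := rfl
    have hv : (t • x).left.vec = t • x.left.vec := rfl
    have hs : (t • x).left.cen = t * x.left.cen := rfl
    simp only [infAction, multiplier, hA, hv, hs]
    refine Prod.ext ?_ (Prod.ext ?_ ?_)
    · ext a; simp
    · simp; ring
    · simp [smul_comm t]

theorem actionAtZero_apply (x : LieL m) : actionAtZero m c x =
    (fun a => x.right.1.1 a.succ 0, -2 * c * (x.right.1.1 0 0).im + x.left.cen,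
      ((1 / (2 * √2) : ℝ) : ℂ) • x.left.vec) := by
  change infAction c x 0 = _
  simp only [infAction, multiplier]
  refine Prod.ext ?_ (Prod.ext ?_ ?_)
  · ext a; simp
  · simp
  · ext k; simp

theorem actionAtZero_bijective : Function.Bijective (actionAtZero m c) := by
  constructor
  · rw [← LinearMap.ker_eq_bot, LinearMap.ker_eq_bot']
    intro x hx
    rw [actionAtZero_apply] at hx
    have hA : x.right = 0 := Subtype.ext
      (eq_zero_of_mem_iwasawa x.right.2 (congrFun (congrArg Prod.fst hx)))
    have h2 : -2 * c * (x.right.1.1 0 0).im + x.left.cen = 0 := congrArg (fun p => p.2.1) hx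
    have h3 : ((1 / (2 * √2) : ℝ) : ℂ) • x.left.vec = 0 := congrArg (fun p => p.2.2) hx
    have hv : x.left.vec = 0 := (smul_eq_zero.1 h3).resolve_left (by simp)
    have hs : x.left.cen = 0 := by
      rw [hA] at h2
      change -2 * c * (0 : ℂ).im + x.left.cen = 0 at h2
      simpa using h2
    exact LieAlgebra.SemiDirectSum.ext (Heis.ext hv hs) hA
  · rintro ⟨X, s, w⟩
    refine ⟨⟨⟨((2 * √2 : ℝ) : ℂ) • w, s + 2 * c * ((iwasawaOfCol X).1.1 0 0).im⟩,
      iwasawaOfCol X⟩, ?_⟩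
    rw [actionAtZero_apply]
    refine Prod.ext ?_ (Prod.ext ?_ ?_)
    · exact funext fun a => iwasawaOfCol_apply X a
    · simp
    · simp only [smul_smul]
      rw [← Complex.ofReal_mul, one_div_mul_cancel (by positivity)]
      simp

/-- The isomorphism `α_ρ : 𝔩 → T_{p_ρ}` of the Lie algebra with the tangent space. -/
def alpha (m : ℕ) (c : ℝ) : LieL m ≃ₗ[ℝ] Coord m :=
  LinearEquiv.ofBijective (actionAtZero m c) (actionAtZero_bijective c)

theorem alpha_BR (a : Fin m) : alpha m c ⟨0, BR a⟩ = vecX a (colCoeff a) := by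
  refine (actionAtZero_apply c _).trans ?_
  refine Prod.ext ?_ (Prod.ext ?_ ?_)
  · ext1 b; simp [BR_apply, vecX, Pi.single_apply]
  · simp [BR_zero_zero, vecX]
  · simp [vecX]

theorem alpha_BI (a : Fin m) : alpha m c ⟨0, BI a⟩ =
    vecX a (colCoeff a * Complex.I) + (if a.val = 0 then -2 * c else 0) • vecPhi m := by
  refine (actionAtZero_apply c _).trans ?_
  refine Prod.ext ?_ (Prod.ext ?_ ?_)
  · ext1 b; by_cases h : a.val = 0 <;> simp [BI_apply, vecX, vecPhi, Pi.single_apply, h]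
  · by_cases h : a.val = 0 <;> simp [BI_zero_zero, vecX, vecPhi, h]
  · by_cases h : a.val = 0 <;> simp [vecX, vecPhi, h]

theorem alpha_eVec (k : Fin (m + 1)) :
    alpha m c (eVec k) = vecW k ((1 / (2 * √2) : ℝ) : ℂ) := by
  refine (actionAtZero_apply c _).trans ?_
  refine Prod.ext ?_ (Prod.ext ?_ ?_)
  · ext1 b; simp [eVec, vecW]
  · simp [eVec, vecW]
  · ext1 l; simp [eVec, vecW, Pi.single_apply]

theorem alpha_fVec (k : Fin (m + 1)) :
    alpha m c (fVec k) = vecW k (((1 / (2 * √2) : ℝ) : ℂ) * Complex.I) := by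
  refine (actionAtZero_apply c _).trans ?_
  refine Prod.ext ?_ (Prod.ext ?_ ?_)
  · ext1 b; simp [fVec, vecW]
  · simp [fVec, vecW]
  · ext1 l; simp [fVec, vecW, Pi.single_apply]

theorem alpha_Zvec : alpha m c (Zvec m) = vecPhi m := by
  refine (actionAtZero_apply c _).trans ?_
  refine Prod.ext ?_ (Prod.ext ?_ ?_)
  · ext1 b; simp [Zvec, vecPhi]
  · simp [Zvec, vecPhi]
  · simp [Zvec, vecPhi]

theorem smul_vecX (r : ℝ) (a : Fin m) (z : ℂ) : r • vecX a z = vecX a (r * z) := by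
  refine Prod.ext ?_ (Prod.ext ?_ ?_)
  · ext1 b; simp [vecX, Pi.single_apply]
  · simp [vecX]
  · simp [vecX]

theorem smul_vecW (r : ℝ) (k : Fin (m + 1)) (z : ℂ) : r • vecW k z = vecW k (r * z) := by
  refine Prod.ext ?_ (Prod.ext ?_ ?_)
  · simp [vecW]
  · simp [vecW]
  · ext1 b; simp [vecW, Pi.single_apply]

/-- The coordinate direction corresponding to the `i`-th element of `𝓑_n`. -/
def coordIndex (m : ℕ) (i : Fin (4 * m + 3)) :
    (_ : Fin m) × Fin 2 ⊕ Unit ⊕ (_ : Fin (m + 1)) × Fin 2 :=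
  if h : i.val < 2 * m then .inl ⟨⟨i.val / 2, by omega⟩, ⟨i.val % 2, by omega⟩⟩
  else if h' : i.val < 4 * m + 2 then
    .inr (.inr ⟨⟨i.val / 2 - m, by omega⟩, ⟨i.val % 2, by omega⟩⟩)
  else .inr (.inl ())

/-- The length factor between the `i`-th element of `𝓑_n` and the coordinate direction: it is
`colCoeff a` for `B_a^R` and `B_a^I`, and comes from the term `v / (2√2)` of the action for `e_k`
and `f_k`. -/
def coordScale (m : ℕ) (i : Fin (4 * m + 3)) : ℝ :=
  if i.val < 2 * m then (if i.val < 2 then 1 else 1 / 2)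
  else if i.val < 4 * m + 2 then 1 / (2 * √2) else 1

/-- The `∂_φ̃` component of the `i`-th element of `𝓑_n`, which vanishes except for `B_1^I`. The index `1`
belongs to `B_1^I` only if `n > 1`; for `n = 1` it is the index of `f_0`. -/
def coordShift (m : ℕ) (c : ℝ) (i : Fin (4 * m + 3)) : ℝ :=
  if i.val = 1 ∧ 0 < m then -2 * c else 0

theorem coordScale_ne_zero (i) : coordScale m i ≠ 0 := by
  unfold coordScale; split_ifs <;> positivity

theorem coordIndex_injective : Function.Injective (coordIndex m) := by
  intro i j h
  have hi := i.2
  have hj := j.2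
  unfold coordIndex at h
  split_ifs at h <;> simp at h <;> ext <;> omega

theorem coordIndex_surjective : Function.Surjective (coordIndex m) :=
  ((Fintype.bijective_iff_injective_and_card _).2
    ⟨coordIndex_injective, by simp; omega⟩).2

theorem coordBasis_coordIndex_last :
    coordBasis m (coordIndex m (Fin.last (4 * m + 2))) = vecPhi m := by
  have h : ¬ (4 * m + 2 < 2 * m) := by omega
  simp [coordIndex, h, coordBasis_phi]

/-- `α_ρ` maps `𝓑_n` to the rescaled coordinate basis, up to the `∂_φ̃` component of `B_1^I`. -/
theorem alpha_basisB (i : Fin (4 * m + 3)) : alpha m c (basisB m i) =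
    coordScale m i • coordBasis m (coordIndex m i) + coordShift m c i • vecPhi m := by
  have hi := i.2
  by_cases h1 : i.val < 2 * m
  · have hm : 0 < m := by omega
    by_cases h3 : i.val % 2 = 0
    · have h4 : ¬ (i.val = 1) := by omega
      simp [basisB, coordIndex, coordScale, coordShift, h1, h3, h4, alpha_BR, coordBasis_X,
        smul_vecX, colCoeff]
      split_ifs <;> simp
    · have h3' : i.val % 2 = 1 := by omega
      have h4 : i.val = 1 ↔ i.val < 2 := by omega
      simp [basisB, coordIndex, coordScale, coordShift, h1, h3', h4, hm, alpha_BI, coordBasis_X,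
        smul_vecX, colCoeff]
      split_ifs <;> simp
  · have h0 : ¬ (i.val = 1 ∧ 0 < m) := by omega
    by_cases h2 : i.val < 4 * m + 2
    · by_cases h3 : i.val % 2 = 0
      · simp [basisB, coordIndex, coordScale, coordShift, h0, h1, h2, h3, alpha_eVec, coordBasis_W,
          smul_vecW]
      · have h3' : i.val % 2 = 1 := by omega
        simp [basisB, coordIndex, coordScale, coordShift, h0, h1, h2, h3', alpha_fVec, coordBasis_W,
          smul_vecW]
    · simp [basisB, coordIndex, coordScale, coordShift, h0, h1, h2, alpha_Zvec, coordBasis_phi]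

theorem span_basisB : ⊤ ≤ Submodule.span ℝ (Set.range (basisB m)) := by
  have hlast : vecPhi m ∈ (Submodule.span ℝ (Set.range (basisB m))).map (alpha m 0).toLinearMap := by
    refine ⟨basisB m (Fin.last _), Submodule.subset_span ⟨_, rfl⟩, ?_⟩
    have h : ¬ (4 * m + 2 < 2 * m) := by omega
    have : basisB m (Fin.last (4 * m + 2)) = Zvec m := by simp [basisB, h]
    rw [this]
    exact alpha_Zvec 0
  -- every coordinate vector is a combination of `α (𝓑 i)` and `∂_φ̃ = α (Z)`
  have hall : ∀ j, coordBasis m j ∈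
      (Submodule.span ℝ (Set.range (basisB m))).map (alpha m 0).toLinearMap := by
    intro j
    obtain ⟨i, rfl⟩ := coordIndex_surjective j
    have h : coordBasis m (coordIndex m i) = (coordScale m i)⁻¹ •
        (alpha m 0 (basisB m i) - coordShift m 0 i • vecPhi m) := by
      rw [alpha_basisB, add_sub_cancel_right, inv_smul_smul₀ (coordScale_ne_zero i)]
    rw [h]
    exact Submodule.smul_mem _ _ (Submodule.sub_mem _
      ⟨_, Submodule.subset_span ⟨i, rfl⟩, rfl⟩ (Submodule.smul_mem _ _ hlast))
  have htop : (Submodule.span ℝ (Set.range (basisB m))).map (alpha m 0).toLinearMap = ⊤ := by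
    rw [eq_top_iff, ← (coordBasis m).span_eq, Submodule.span_le]
    rintro _ ⟨j, rfl⟩
    exact hall j
  intro x _
  obtain ⟨y, hy, hxy⟩ := htop.ge (Submodule.mem_top (x := alpha m 0 x))
  rwa [← (alpha m 0).injective hxy]

theorem finrank_LieL : Module.finrank ℝ (LieL m) = 4 * m + 3 := by
  rw [(alpha m 0).finrank_eq, Module.finrank_eq_card_basis (coordBasis m)]
  simp
  omega

/-- The family `𝓑_n` as a basis of `𝔩`. -/
def lieBasis (m : ℕ) : Module.Basis (Fin (4 * m + 3)) ℝ (LieL m) :=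
  basisOfTopLeSpanOfCardEqFinrank (basisB m) span_basisB (by rw [finrank_LieL, Fintype.card_fin])

theorem lieBasis_apply (i) : lieBasis m i = basisB m i := by
  simp [lieBasis]

/-- The squared lengths of the coordinate vectors. -/
theorem gmet_coordBasis_self (j) : gmet m ρ c 0 (coordBasis m j) (coordBasis m j) =
    match j with
    | .inl _ => coeffX ρ c
    | .inr (.inl _) => coeffPhi ρ c
    | .inr (.inr ⟨k, _⟩) => if k = 0 then coeffU ρ c - coeffW ρ else coeffW ρ := by
  have hI : ∀ l : Fin 2, (conj (![1, Complex.I] l) * ![1, Complex.I] l : ℂ).re = 1 := by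
    intro l; fin_cases l <;> simp
  rcases j with ⟨a, l⟩ | u | ⟨k, l⟩
  · have : (vecX a (![1, Complex.I] l)).1 a = ![1, Complex.I] l := by simp [vecX]
    rw [coordBasis_X, gmet_zero_vecX, this, hI, mul_one]
  · rw [coordBasis_phi, gmet_zero_vecPhi]; simp [vecPhi]
  · have : (vecW k (![1, Complex.I] l)).2.2 k = ![1, Complex.I] l := by simp [vecW]
    rw [coordBasis_W]
    revert this
    refine Fin.cases (fun this => ?_) (fun a this => ?_) k
    · rw [gmet_zero_vecW_zero, this, hI]; simp
    · rw [gmet_zero_vecW_succ, this, hI]; simp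

theorem ricciEnd_coordBasis {ρ c : ℝ} (hρ : 0 < ρ) (hc : 0 ≤ c) (j) :
    ricciEnd (gmet m ρ c) 0 (coordBasis m j) =
    (match j with
    | .inl _ => r1 (m + 1) ρ c
    | .inr (.inl _) => r2 (m + 1) ρ c
    | .inr (.inr ⟨k, _⟩) => if k = 0 then r3 (m + 1) ρ c else r4 ρ c) • coordBasis m j := by
  rw [ricciEnd_gmet_zero hρ hc]
  have hcons : (Fin.cons 0 0 : Fin (m + 1) → ℂ) = 0 := by
    ext k; refine Fin.cases ?_ (fun b => ?_) k <;> simp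
  rcases j with ⟨a, l⟩ | u | ⟨k, l⟩
  · rw [coordBasis_X, wTail_vecX]
    simp [vecX, hcons]
  · rw [coordBasis_phi, wTail_vecPhi]
    simp [vecPhi, hcons]
  · rw [coordBasis_W]
    refine Fin.cases ?_ (fun a => ?_) k
    · rw [wTail_vecW_zero]
      refine Prod.ext (by simp [vecW]) (Prod.ext (by simp [vecW]) ?_)
      ext b
      refine Fin.cases ?_ (fun b => ?_) b <;> simp [vecW]
    · rw [wTail_vecW_succ]
      refine Prod.ext (by simp [vecW]) (Prod.ext (by simp [vecW]) ?_)
      ext b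
      refine Fin.cases ?_ (fun b => ?_) b <;> simp [vecW, Pi.single_apply]

end Isomorphism

/-! ### The Gram matrix and the matrix of the Ricci endomorphism -/

section Matrices

variable {m : ℕ} {ρ c : ℝ}

theorem gmet_coordBasis_vecPhi (i : Fin (4 * m + 3)) :
    gmet m ρ c 0 (coordBasis m (coordIndex m i)) (vecPhi m) =
      if i = Fin.last (4 * m + 2) then coeffPhi ρ c else 0 := by
  split_ifs with h
  · rw [h, coordBasis_coordIndex_last, gmet_zero_vecPhi]; simp [vecPhi]
  · rw [← coordBasis_coordIndex_last]
    exact coordBasis_orthogonal _ _ (coordIndex_injective.ne h)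

/-- The coordinate basis is orthogonal, so that off the diagonal only the `∂_φ̃` component of `B_1^I`
contributes. -/
theorem gmet_alpha_basisB (i j : Fin (4 * m + 3)) :
    gmet m ρ c 0 (alpha m c (basisB m i)) (alpha m c (basisB m j)) =
      (if i = j then coordScale m i ^ 2 *
        gmet m ρ c 0 (coordBasis m (coordIndex m i)) (coordBasis m (coordIndex m i)) else 0)
      + (if i = Fin.last _ then coordScale m i * coordShift m c j * coeffPhi ρ c else 0)
      + (if j = Fin.last _ then coordScale m j * coordShift m c i * coeffPhi ρ c else 0)
      + coordShift m c i * coordShift m c j * coeffPhi ρ c := by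
  have hΦ : gmet m ρ c 0 (vecPhi m) (vecPhi m) = coeffPhi ρ c := by
    rw [gmet_zero_vecPhi]; simp [vecPhi]
  rw [alpha_basisB, alpha_basisB]
  simp only [map_add, map_smul, add_apply, smul_apply, smul_eq_mul, hΦ,
    gmet_symm ρ c 0 (vecPhi m) (coordBasis m _), gmet_coordBasis_vecPhi]
  have h : gmet m ρ c 0 (coordBasis m (coordIndex m i)) (coordBasis m (coordIndex m j)) =
      if i = j then
        gmet m ρ c 0 (coordBasis m (coordIndex m i)) (coordBasis m (coordIndex m i)) else 0 := by
    split_ifs with h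
    · rw [h]
    · exact coordBasis_orthogonal _ _ (coordIndex_injective.ne h)
  rw [h]
  split_ifs with h1 h2 h3 <;> (try subst h1) <;> ring

/-- The squared lengths of the coordinate directions, scaled as the elements of `𝓑_n`. -/
theorem coordScale_sq_mul (hρ : 0 < ρ) (i : Fin (4 * m + 3)) :
    coordScale m i ^ 2 *
      gmet m ρ c 0 (coordBasis m (coordIndex m i)) (coordBasis m (coordIndex m i)) =
    if i.val < 2 * m then (if i.val < 2 then (ρ + c) / ρ else (ρ + c) / (4 * ρ))
    else if i.val < 2 * m + 2 then (ρ + 2 * c) / (4 * ρ ^ 2)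
    else if i.val < 4 * m + 2 then 1 / (4 * ρ)
    else 1 / (4 * ρ ^ 2) * ((ρ + c) / (ρ + 2 * c)) := by
  have hs : (1 / (2 * √2) : ℝ) ^ 2 = 1 / 8 := by
    rw [div_pow, mul_pow, Real.sq_sqrt (by norm_num)]; norm_num
  have hi := i.2
  rw [gmet_coordBasis_self, coeffU_sub_coeffW hρ]
  unfold coordIndex coordScale
  by_cases h1 : i.val < 2 * m
  · by_cases h2 : i.val < 2
    · simp [h1, h2, coeffX]
    · simp [h1, h2, coeffX]; field_simp; ring
  · by_cases h2 : i.val < 4 * m + 2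
    · simp only [h1, h2, dif_pos, if_pos, if_false, dif_neg, not_false_eq_true, hs]
      by_cases h3 : i.val < 2 * m + 2
      · have h4 : (⟨i.val / 2 - m, by omega⟩ : Fin (m + 1)) = 0 := Fin.ext (by simp; omega)
        simp only [h4, h3, if_pos]
        field_simp; ring
      · have h4 : (⟨i.val / 2 - m, by omega⟩ : Fin (m + 1)) ≠ 0 := fun h => by
          have := congrArg Fin.val h
          simp at this
          omega
        simp only [h4, h3, if_false, coeffW]
        field_simp; ring
    · have h3 : ¬ i.val < 2 * m + 2 := by omega
      simp [h1, h2, h3, coeffPhi]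

theorem gram_eq_gramMatrix (hm : 0 < m) (hρ : 0 < ρ) (hc : 0 ≤ c) :
    Matrix.of (fun i j => gmet m ρ c 0 (alpha m c (lieBasis m i)) (alpha m c (lieBasis m j))) =
      gramMatrix m ρ c := by
  have h0 : ρ ≠ 0 := hρ.ne'
  have h1 : ρ + c ≠ 0 := by positivity
  have h2 : ρ + 2 * c ≠ 0 := by positivity
  have hone : (1 : Fin (4 * m + 3)).val = 1 := rfl
  ext i j
  have hi := i.2
  have hj := j.2
  rw [Matrix.of_apply, lieBasis_apply, lieBasis_apply, gmet_alpha_basisB, coordScale_sq_mul hρ]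
  simp only [gramMatrix, Matrix.sub_apply, Matrix.smul_apply, Matrix.add_apply, Matrix.single_apply,
    Matrix.diagonal_apply, coordScale, coordShift, Fin.ext_iff, Fin.val_last, hone, hm, and_true,
    smul_eq_mul, coeffPhi, eq_comm (a := 1), eq_comm (a := 4 * m + 2)]
  -- the special rows and columns are those of `B_1^I` (index `1`) and `Z` (index `4 m + 2`)
  by_cases hi1 : i.val = 1 <;> by_cases hil : i.val = 4 * m + 2 <;> by_cases hj1 : j.val = 1 <;>
    by_cases hjl : j.val = 4 * m + 2 <;> by_cases hij : i.val = j.val <;>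
    first
    | (exfalso; omega)
    | (simp only [hi1, hil, hj1, hjl, hij, if_true, if_false, and_true, and_false, mul_zero,
        add_zero, zero_add, sub_zero, zero_mul] <;>
       try split_ifs) <;> first | (exfalso; omega) | (field_simp; try ring)

/-- The eigenvalues of the Ricci endomorphism on the coordinate directions. -/
theorem ricciEnd_coordIndex (hρ : 0 < ρ) (hc : 0 ≤ c) (i : Fin (4 * m + 3)) :
    ricciEnd (gmet m ρ c) 0 (coordBasis m (coordIndex m i)) =
    (if i.val < 2 * m then r1 (m + 1) ρ c
    else if i.val < 2 * m + 2 then r3 (m + 1) ρ c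
    else if i.val < 4 * m + 2 then r4 ρ c
    else r2 (m + 1) ρ c) • coordBasis m (coordIndex m i) := by
  have hi := i.2
  rw [ricciEnd_coordBasis hρ hc]
  congr 1
  unfold coordIndex
  by_cases h1 : i.val < 2 * m
  · simp [h1]
  · by_cases h2 : i.val < 4 * m + 2
    · simp only [h1, h2, dif_pos, if_pos, if_false, dif_neg, not_false_eq_true]
      by_cases h3 : i.val < 2 * m + 2
      · have h4 : (⟨i.val / 2 - m, by omega⟩ : Fin (m + 1)) = 0 := Fin.ext (by simp; omega)
        simp only [h4, h3, if_pos]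
      · have h4 : (⟨i.val / 2 - m, by omega⟩ : Fin (m + 1)) ≠ 0 := fun h => by
          have := congrArg Fin.val h
          simp at this
          omega
        simp only [h4, h3, if_false]
    · have h3 : ¬ i.val < 2 * m + 2 := by omega
      simp [h1, h2, h3]

/-- The Ricci endomorphism on `𝓑_n`: every element is an eigenvector up to a multiple of `Z`. -/
theorem ricciEnd_alpha_basisB (hρ : 0 < ρ) (hc : 0 ≤ c) (i : Fin (4 * m + 3)) :
    ricciEnd (gmet m ρ c) 0 (alpha m c (basisB m i)) =
    (if i.val < 2 * m then r1 (m + 1) ρ c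
    else if i.val < 2 * m + 2 then r3 (m + 1) ρ c
    else if i.val < 4 * m + 2 then r4 ρ c
    else r2 (m + 1) ρ c) • alpha m c (basisB m i)
      + ((r2 (m + 1) ρ c - r1 (m + 1) ρ c) * coordShift m c i) • vecPhi m := by
  have hΦ : ricciEnd (gmet m ρ c) 0 (vecPhi m) = r2 (m + 1) ρ c • vecPhi m := by
    have := ricciEnd_coordBasis (m := m) hρ hc (.inr (.inl ()))
    rwa [coordBasis_phi] at this
  rw [alpha_basisB, map_add, map_smul, map_smul, ricciEnd_coordIndex hρ hc, hΦ]
  by_cases h : i.val = 1 ∧ 0 < m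
  · have h1 : i.val < 2 * m := by omega
    rw [if_pos h1]
    module
  · have h1 : coordShift m c i = 0 := if_neg h
    rw [h1]
    module

theorem ricciEnd_toMatrix (hm : 0 < m) (hρ : 0 < ρ) (hc : 0 ≤ c) :
    LinearMap.toMatrix (lieBasis m) (lieBasis m)
        ((alpha m c).symm.toLinearMap ∘ₗ ricciEnd (gmet m ρ c) 0 ∘ₗ (alpha m c).toLinearMap) =
      ricciMatrix m ρ c := by
  have hZ : (alpha m c).symm (vecPhi m) = lieBasis m (Fin.last _) := by
    have h : ¬ (4 * m + 2 < 2 * m) := by omega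
    rw [LinearEquiv.symm_apply_eq, lieBasis_apply, ← alpha_Zvec c]
    simp [basisB, h]
  have hone : (1 : Fin (4 * m + 3)).val = 1 := rfl
  ext i j
  rw [LinearMap.toMatrix_apply]
  simp only [LinearMap.comp_apply, LinearEquiv.coe_coe]
  rw [lieBasis_apply, ricciEnd_alpha_basisB hρ hc, map_add, map_smul, map_smul, hZ,
    LinearEquiv.symm_apply_apply, ← lieBasis_apply]
  simp only [map_add, map_smul, Module.Basis.repr_self, Finsupp.add_apply, Finsupp.smul_apply,
    Finsupp.single_apply, ricciMatrix, Matrix.add_apply, Matrix.smul_apply, Matrix.diagonal_apply,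
    Matrix.single_apply, smul_eq_mul, coordShift, hm, and_true]
  by_cases hij : i = j
  · subst hij
    simp only [Fin.ext_iff, Fin.val_last, hone]
    split_ifs <;> first | (exfalso; omega) | ring
  · simp only [hij, Ne.symm hij, if_false, Fin.ext_iff, Fin.val_last, hone]
    split_ifs <;> first | (exfalso; omega) | ring

theorem gram_one (hρ : 0 < ρ) (hc : 0 ≤ c) :
    Matrix.of (fun i j => gmet 0 ρ c 0 (alpha 0 c (lieBasis 0 i)) (alpha 0 c (lieBasis 0 j))) =
      !![(2 * c + ρ) / (4 * ρ ^ 2), 0, 0;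
         0, (2 * c + ρ) / (4 * ρ ^ 2), 0;
         0, 0, (c + ρ) / (4 * (2 * c + ρ) * ρ ^ 2)] := by
  have h2 : ρ + 2 * c ≠ 0 := by positivity
  have h3 : 2 * c + ρ ≠ 0 := by positivity
  have h0 : ρ ≠ 0 := hρ.ne'
  have hs : ∀ i, coordShift 0 c i = 0 := fun i => if_neg (by simp)
  ext i j
  rw [Matrix.of_apply, lieBasis_apply, lieBasis_apply, gmet_alpha_basisB, coordScale_sq_mul hρ, hs,
    hs]
  fin_cases i <;> fin_cases j <;> simp <;> field_simp <;> ring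

theorem ricciEnd_toMatrix_one (hρ : 0 < ρ) (hc : 0 ≤ c) :
    LinearMap.toMatrix (lieBasis 0) (lieBasis 0)
        ((alpha 0 c).symm.toLinearMap ∘ₗ ricciEnd (gmet 0 ρ c) 0 ∘ₗ (alpha 0 c).toLinearMap) =
      (2 * ρ ^ 2 * (c + ρ) / (2 * c + ρ) ^ 3) • !![-1, 0, 0; 0, -1, 0; 0, 0, 1] := by
  have h1 : ρ + c ≠ 0 := by positivity
  have h2 : ρ + 2 * c ≠ 0 := by positivity
  have h3 : 2 * c + ρ ≠ 0 := by positivity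
  have hr2 : r2 ((0 : ℕ) + 1) ρ c = 2 * ρ ^ 2 * (c + ρ) / (2 * c + ρ) ^ 3 := by
    rw [r2]; field_simp; push_cast; ring
  have hr3 : r3 ((0 : ℕ) + 1) ρ c = -(2 * ρ ^ 2 * (c + ρ) / (2 * c + ρ) ^ 3) := by
    rw [r3]; field_simp; push_cast; ring
  ext i j
  rw [LinearMap.toMatrix_apply]
  simp only [LinearMap.comp_apply, LinearEquiv.coe_coe]
  have hs : coordShift 0 c j = 0 := if_neg (by simp)
  have h := ricciEnd_alpha_basisB (m := 0) hρ hc j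
  rw [hr2, hr3, hs, mul_zero (_ - _), zero_smul, add_zero, ← lieBasis_apply] at h
  rw [h, map_smul, LinearEquiv.symm_apply_apply, map_smul, Module.Basis.repr_self,
    Finsupp.smul_apply]
  fin_cases i <;> fin_cases j <;> simp

end Matrices

end OneLoop

end

theorem mainTheorem4 (ρ c : ℝ) (hρ : 0 < ρ) (hc : 0 ≤ c) :
    (∀ m : ℕ, 0 < m →
      ∃ (𝓑 : Module.Basis (Fin (4 * m + 3)) ℝ (OneLoop.LieL m))
        (α : OneLoop.LieL m ≃ₗ[ℝ] OneLoop.Coord m),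
        (∀ i, 𝓑 i = OneLoop.basisB m i) ∧
        (∀ x, α x = OneLoop.infAction c x 0) ∧
        Matrix.of (fun i j => OneLoop.gmet m ρ c 0 (α (𝓑 i)) (α (𝓑 j))) =
          OneLoop.gramMatrix m ρ c ∧
        LinearMap.toMatrix 𝓑 𝓑
            (α.symm.toLinearMap ∘ₗ OneLoop.ricciEnd (OneLoop.gmet m ρ c) 0 ∘ₗ α.toLinearMap) =
          OneLoop.ricciMatrix m ρ c) ∧
    (∃ (𝓑 : Module.Basis (Fin 3) ℝ (OneLoop.LieL 0))
        (α : OneLoop.LieL 0 ≃ₗ[ℝ] OneLoop.Coord 0),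
        (∀ i, 𝓑 i = OneLoop.basisB 0 i) ∧
        (∀ x, α x = OneLoop.infAction c x 0) ∧
        Matrix.of (fun i j => OneLoop.gmet 0 ρ c 0 (α (𝓑 i)) (α (𝓑 j))) =
          !![(2 * c + ρ) / (4 * ρ ^ 2), 0, 0;
             0, (2 * c + ρ) / (4 * ρ ^ 2), 0;
             0, 0, (c + ρ) / (4 * (2 * c + ρ) * ρ ^ 2)] ∧
        LinearMap.toMatrix 𝓑 𝓑
            (α.symm.toLinearMap ∘ₗ OneLoop.ricciEnd (OneLoop.gmet 0 ρ c) 0 ∘ₗ α.toLinearMap) =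
          (2 * ρ ^ 2 * (c + ρ) / (2 * c + ρ) ^ 3) • !![-1, 0, 0; 0, -1, 0; 0, 0, 1]) := by
  refine ⟨fun m hm => ⟨OneLoop.lieBasis m, OneLoop.alpha m c, OneLoop.lieBasis_apply, fun _ => rfl,
      OneLoop.gram_eq_gramMatrix hm hρ hc, OneLoop.ricciEnd_toMatrix hm hρ hc⟩,
    OneLoop.lieBasis 0, OneLoop.alpha 0 c, fun i => OneLoop.lieBasis_apply (m := 0) i, fun _ => rfl,
    OneLoop.gram_one hρ hc, OneLoop.ricciEnd_toMatrix_one hρ hc⟩
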